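/- **Setting.** Let $\mathbb R^{n+2}_1$ be Minkowski space with inner product $\langle\cdot,\cdot\rangle$ of signature $(n+1,1)$, let $\mathcal L^{n+1}$ be its light cone (nonzero null vectors), write $v^*=\langle v,\cdot\rangle$, let $(v\wedge w)(x)=\langle v,x\rangle w-\langle w,x\rangle v$, and let $\mathfrak o$ denote the Lie algebra of skew endomorphisms. For a null vector $K$, $KV^*$ and $VK^*$ denote the endomorphisms $x\mapsto\langle V,x\rangle K$ and $x\mapsto\langle K,x\rangle V$. Let $\Delta$ be a compact Riemann surface diffeomorphic to a closed disc, $s$ an interior point of $\Delta$, and $z$ a holomorphic coordinate defined on all of $\Delta$ with $z(s)=0$ (so that $\Delta$ may be regarded as a compact subset of $\mathbb C$ with $s=0$). The universal cover of $\Delta\setminus\{s\}$, with covering map $\mathfrak p$, is denoted by $U$. On $U$ there are polar coordinates $(r,\phi)$ with $z\circ\mathfrak p=re^{i\phi}$, and we write $z(q)$ for $z(\mathfrak p(q))$, $q\in U$. The branched universal cover $U\cup\{s\}$ has the topology in which $A$ is open iff $A\cap U$ is open and, if $s\in A$, there is $\varepsilon>0$ such that $A$ contains all $q\in U$ with $r(q)<\varepsilon$.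 Let $\Xi=\mathrm{Re}\big(-(\Xi^R+i\,\Xi^I)\,dz/z\big)$ with $\Xi^R=v\wedge w$, $\Xi^I=x\wedge y$, $\mathrm{span}(x,y)\subseteq\mathrm{span}(v,w)^\perp$ and $\mathrm{span}(v,w)$ of signature $(1,1)$ (a Minkowski pure pole form). Let $\Psi$ be a smooth $\mathfrak o$-valued 1-form on $\Delta\setminus\{s\}$ such that $d+\Psi$ is flat and $\Psi-\Xi$ is bounded (its components with respect to the real and imaginary parts of $z$ are bounded). For $p\in U$ let $q\mapsto\Gamma_p^q(\Psi)$ be the unique solution on $U$ of $d\Gamma_p=\Gamma_p\,\mathfrak p^*\Psi$, $\Gamma_p^p=\mathrm{id}$. Let $V_\pm\neq 0$ be eigenvectors of $\Xi^R$ with eigenvalues $\pm\zeta$, $\zeta>0$. **Proposition.** There is a smooth map $K:U\to\mathcal L^{n+1}$ such that $$K(p)=\left|\frac{z(q)}{z(p)}\right|^{\zeta}\Gamma_p^{q}(\Psi)\,K(q)\quad\text{for all }p,q\in U,\qquad \lim_{q\to s}K(q)=\frac{V_+}{\langle V_+,V_-\rangle},$$ and such that for every $C\subset U$ on which the angle $\phi$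 is bounded and for which $C\cup\{s\}\subset U\cup\{s\}$ is compact with limit point $s$, and for every $p\in U$, $$\lim_{C\ni q\to s}\left|\frac{z(q)}{z(p)}\right|^{\zeta}\Gamma_p^{q}(\Psi)=K(p)V_-^*,\qquad \lim_{C\ni q\to s}\left|\frac{z(q)}{z(p)}\right|^{\zeta}\Gamma_q^{p}(\Psi)=V_-K(p)^*.$$ -/

import Mathlib

open Set Filter Topology
open scoped ContDiff

namespace PoleForm

noncomputable section

/-! ### Minkowski space -/

/-- The vector space underlying `(n+2)`-dimensional Minkowski space. Its Euclidean norm is only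
used as an auxiliary positive definite norm. -/
abbrev Mink (n : ℕ) : Type := EuclideanSpace ℝ (Fin (n + 2))

/-- Endomorphisms of Minkowski space; the product is composition. -/
abbrev EndMink (n : ℕ) : Type := Mink n →L[ℝ] Mink n

/-- The Minkowski inner product, of signature `(n+1, 1)`. -/
def ip {n : ℕ} (x y : Mink n) : ℝ := -(x 0 * y 0) + ∑ i : Fin (n + 1), x i.succ * y i.succ

/-- `v^*`, the linear form `x ↦ ⟨v, x⟩`. -/
def dual {n : ℕ} (v : Mink n) : Mink n →L[ℝ] ℝ :=
  LinearMap.toContinuousLinearMap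
    { toFun := fun x => ip v x
      map_add' := fun x y => by
        simp only [ip, PiLp.add_apply, mul_add, Finset.sum_add_distrib]
        ring
      map_smul' := fun c x => by
        simp only [ip, PiLp.smul_apply, smul_eq_mul, RingHom.id_apply, mul_add, Finset.mul_sum]
        congr 1
        · ring
        · exact Finset.sum_congr rfl fun i _ => by ring }

/-- The endomorphism `a b^*`, that is, `x ↦ ⟨b, x⟩ a`. -/
def outer {n : ℕ} (a b : Mink n) : EndMink n := (dual b).smulRight a

/-- `v ∧ w`, that is, `x ↦ ⟨v, x⟩ w - ⟨w, x⟩ v`. -/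
def wedge {n : ℕ} (v w : Mink n) : EndMink n := outer w v - outer v w

/-- Membership in the Lie algebra `𝔬` of the Lorentz group. -/
def IsSkew {n : ℕ} (A : EndMink n) : Prop := ∀ x y : Mink n, ip (A x) y = -ip x (A y)

/-- The light cone: the nonzero null vectors. -/
def lightCone (n : ℕ) : Set (Mink n) := {x | x ≠ 0 ∧ ip x x = 0}

/-- The span of `v, w` has Minkowski signature `(1, 1)`: being at most two-dimensional, this means
that it contains both a timelike and a spacelike vector. -/
def SpanIsMinkowski {n : ℕ} (v w : Mink n) : Prop :=
  (∃ a ∈ Submodule.span ℝ {v, w}, ip a a < 0) ∧ (∃ b ∈ Submodule.span ℝ {v, w}, 0 < ip b b)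

/-- `⟨x, y⟩ ⊆ ⟨v, w⟩^⊥` for the spans of `x, y` and of `v, w`. -/
def SpansOrthogonal {n : ℕ} (x y v w : Mink n) : Prop :=
  ∀ a ∈ Submodule.span ℝ {x, y}, ∀ b ∈ Submodule.span ℝ {v, w}, ip a b = 0

/-! ### The disc, and forms on the punctured disc

The disc `Δ` is described in its globally defined holomorphic coordinate `z`, with `z(s) = 0`:
it is a compact subset of `ℂ`, `s` is the point `0`, and `z` is the identity. -/

/-- `Δ` is diffeomorphic, up to the boundary, to the closed unit disc, and `0` is an interior
point of it. -/
def IsDiscAroundZero (Δ : Set ℂ) : Prop :=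
  (∃ f g : ℂ → ℂ, ContDiffOn ℝ ∞ f (Metric.closedBall 0 1) ∧ ContDiffOn ℝ ∞ g Δ ∧
    f '' Metric.closedBall 0 1 = Δ ∧ ∀ u ∈ Metric.closedBall (0 : ℂ) 1, g (f u) = u) ∧
  (0 : ℂ) ∈ interior Δ

/-- Endomorphism-valued real 1-forms on subsets of `ℂ`. -/
abbrev Form (n : ℕ) : Type := ℂ → ℂ →L[ℝ] EndMink n

/-- The 1-form `Re (-(A + iB) dz/z)`, that is, `-A Re(dz/z) + B Im(dz/z)`. -/
def pureForm {n : ℕ} (A B : EndMink n) : Form n := fun z =>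
  let dlog : ℂ →L[ℝ] ℂ := z⁻¹ • ContinuousLinearMap.id ℝ ℂ
  (-(Complex.reCLM ∘L dlog)).smulRight A + (Complex.imCLM ∘L dlog).smulRight B

/-- Flatness on `S` of `d + ψ`: `dψ + ψ ∧ ψ = 0`. -/
def IsFlatOn {n : ℕ} (ψ : Form n) (S : Set ℂ) : Prop :=
  ∀ z ∈ S, ∀ a b : ℂ,
    fderivWithin ℝ ψ S z a b - fderivWithin ℝ ψ S z b a + (ψ z a * ψ z b - ψ z b * ψ z a) = 0

/-- `ψ` is (the orthogonal lift of) a pole form on the punctured disc whose difference from the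
1-form `ξ` is bounded. -/
structure IsPoleForm {n : ℕ} (Δ : Set ℂ) (ψ ξ : Form n) : Prop where
  smooth : ContDiffOn ℝ ∞ ψ (Δ \ {0})
  skew : ∀ z ∈ Δ \ {0}, ∀ a : ℂ, IsSkew (ψ z a)
  flat : IsFlatOn ψ (Δ \ {0})
  bounded : ∃ B : ℝ, ∀ z ∈ Δ \ {0}, ‖ψ z - ξ z‖ ≤ B

/-! ### The universal cover and the branched universal cover -/

/-- The universal cover of the punctured disc, with covering map `exp`. The point
`ln r + i φ` of it has polar coordinates `(r, φ)`. -/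
def cover (Δ : Set ℂ) : Set ℂ := {u | Complex.exp u ∈ Δ}

/-- The angular polar coordinate on the universal cover. -/
def angle {Δ : Set ℂ} (q : cover Δ) : ℝ := (q : ℂ).im

/-- The branched universal cover: one point `s` is added to the universal cover. -/
inductive BranchedCover (Δ : Set ℂ) : Type
  | s : BranchedCover Δ
  | pt : cover Δ → BranchedCover Δ

/-- A set is open if its part in the universal cover is open and, in case it contains `s`,
it contains all points of the universal cover whose radius is small enough. -/
instance (Δ : Set ℂ) : TopologicalSpace (BranchedCover Δ) where
  IsOpen A := IsOpen (BranchedCover.pt ⁻¹' A) ∧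
    (BranchedCover.s ∈ A → ∃ ε : ℝ, 0 < ε ∧
      ∀ q : cover Δ, ‖Complex.exp (q : ℂ)‖ < ε → BranchedCover.pt q ∈ A)
  isOpen_univ := ⟨isOpen_univ, fun _ => ⟨1, one_pos, fun _ _ => mem_univ _⟩⟩
  isOpen_inter A B hA hB := by
    refine ⟨hA.1.inter hB.1, fun h => ?_⟩
    obtain ⟨ε, hε, h1⟩ := hA.2 h.1
    obtain ⟨δ, hδ, h2⟩ := hB.2 h.2
    exact ⟨min ε δ, lt_min hε hδ, fun q hq =>
      ⟨h1 q (hq.trans_le (min_le_left _ _)), h2 q (hq.trans_le (min_le_right _ _))⟩⟩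
  isOpen_sUnion F hF := by
    refine ⟨?_, ?_⟩
    · rw [preimage_sUnion]
      exact isOpen_biUnion fun A hA => (hF A hA).1
    · rintro ⟨A, hA, hs⟩
      obtain ⟨ε, hε, h⟩ := (hF A hA).2 hs
      exact ⟨ε, hε, fun q hq => ⟨A, hA, h q hq⟩⟩

/-- The filter of neighbourhoods of `s` in the branched cover, restricted to the universal
cover: this is what `q → s` means. -/
def toS (Δ : Set ℂ) : Filter (cover Δ) := comap BranchedCover.pt (𝓝 BranchedCover.s)

/-- `C ∪ {s}` is a compact subset of the branched universal cover with limit point `s`, and the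
angular coordinate is bounded on `C`. -/
structure IsApproachSet {Δ : Set ℂ} (C : Set (cover Δ)) : Prop where
  compact : IsCompact (insert BranchedCover.s (BranchedCover.pt '' C))
  limitPoint : BranchedCover.s ∈ closure (BranchedCover.pt '' C)
  angle_bounded : ∃ M : ℝ, ∀ q ∈ C, |angle q| ≤ M

/-! ### Primitives -/

/-- The pullback of a 1-form by the covering map `exp`. -/
def pullback {n : ℕ} (ψ : Form n) : Form n := fun u =>
  ψ (Complex.exp u) ∘L (Complex.exp u • ContinuousLinearMap.id ℝ ℂ)

/-- `G` is a primitive, on the universal cover, of the pullback of `ψ`, normalized at `p`: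
`dG = G ψ` and `G(p) = id`. -/
def IsPrimitive {n : ℕ} (Δ : Set ℂ) (ψ : Form n) (p : ℂ) (G : ℂ → EndMink n) : Prop :=
  G p = 1 ∧ ∀ q ∈ cover Δ,
    HasFDerivWithinAt G (ContinuousLinearMap.compL ℝ (Mink n) (Mink n) (Mink n) (G q) ∘L pullback ψ q)
      (cover Δ) q

open Classical in
/-- `Γ_p^q`, the value at `q` of the primitive normalized at `p`, which is unique on the universal
cover and exists if `d + ψ` is flat. -/
def primitive {n : ℕ} (Δ : Set ℂ) (ψ : Form n) (p q : cover Δ) : EndMink n :=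
  if h : ∃ G : ℂ → EndMink n, IsPrimitive Δ ψ p G then h.choose q else 1

/-- The factor `|z(q) / z(p)|`, for `z` pulled back to the universal cover. -/
def ratio {Δ : Set ℂ} (q p : cover Δ) : ℝ := ‖Complex.exp (q : ℂ) / Complex.exp (p : ℂ)‖

end

end PoleForm

/-!
The universal cover carries the logarithmic coordinate `u = t + iφ`, in which the pullback of `ψ` is
`η = -A dt + B dφ + O(e^t)` with `A = v ∧ w` and `B = x ∧ y`. Here `A` is diagonalizable with the
null eigenlines of `V±` for `±ζ` and the kernel `{V₊, V₋}^⊥`, and `B V± = 0`.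

Let `G` be a Lorentz-valued solution of `dG = G η`, so that `Γ_p^q = G(p)⁻¹ G(q)`, and put
`H = e^{ζt} G`. Along a ray `φ = const`, `H' = H (ζ - A + O(e^t))`. The eigenvalues of `ζ - A` are
`0`, `ζ`, `2ζ`, so as `t → -∞` the unperturbed flow stays bounded and contracts everything but
`V₊`; as the perturbation is integrable, `H` stays bounded, `H V₊` converges, and `H` tends to zero on
the other two eigenspaces (`IsRadialSolution.norm_le_mul`, `norm_mul_pos_sub_le`,
`norm_mul_le_of_decay`). In the angular direction `∂_φ (H V₊) = H (B + O(e^t)) V₊ = O(e^t)`, so the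
limit of `H V₊` does not depend on the ray. Hence `H(q)` converges, uniformly for bounded angles,
to a map of rank one `K₀ V₋^*` (`IsPoleSolution.exists_limit`). The section sought is
`K(p) = H(p)⁻¹ K₀`. It is null because `H` is conformal with a factor that tends to zero, and it tends
to `V₊ / ⟨V₊, V₋⟩` uniformly in the angle, because the estimates along rays, normalized at `p`, are
uniform in `p` (`IsPoleSolution.norm_inv_mul_limit_sub_le`). The last limit is the Minkowski adjoint
of the one before.

The solution `G` has to be found on the universal cover of all of `Δ \ {0}`, up to the boundary, where
flatness is all that is known. A flat form on a closed convex set has a primitive, obtained by solving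
the linear equation along the segments from a base point
(`exists_isPrimitiveWithin_of_flatWithin`). The cover is diffeomorphic to the closed left half-plane
(`IsDiscAroundZero.exists_cover_diffeo`): after a Möbius transformation, the chart
from the closed unit disc to `Δ` fixes `0`, and lifts through `exp` to a map of winding number `±1`.
-/

namespace PoleForm

/-! ### Linear differential equations and primitives of flat forms -/

section FlatForms

variable {𝔸 : Type*} [NormedRing 𝔸] [NormedAlgebra ℝ 𝔸]

theorem norm_intervalIntegral_zero_le_pow {f : ℝ → 𝔸} {c : ℝ} {n : ℕ}
    (h : ∀ x, ‖f x‖ ≤ c * |x| ^ n) (s : ℝ) :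
    ‖∫ x in (0 : ℝ)..s, f x‖ ≤ c * |s| ^ (n + 1) / (n + 1) := by
  have key : ∀ g : ℝ → 𝔸, (∀ x, ‖g x‖ ≤ c * |x| ^ n) → ∀ s : ℝ, 0 ≤ s →
      ‖∫ x in (0 : ℝ)..s, g x‖ ≤ c * |s| ^ (n + 1) / (n + 1) := by
    intro g hg s hs
    have h1 : ‖∫ x in (0 : ℝ)..s, g x‖ ≤ ∫ x in (0 : ℝ)..s, c * x ^ n := by
      refine intervalIntegral.norm_integral_le_of_norm_le hs ?_ ?_
      · refine MeasureTheory.ae_of_all _ fun x hx => ?_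
        simpa [abs_of_pos hx.1] using hg x
      · exact Continuous.intervalIntegrable (by fun_prop) _ _
    refine h1.trans (le_of_eq ?_)
    rw [intervalIntegral.integral_const_mul, integral_pow, abs_of_nonneg hs]
    simp [mul_div_assoc]
  rcases le_total 0 s with hs | hs
  · exact key f h s hs
  · have h2 := key (fun x => f (-x)) (fun x => by simpa using h (-x)) (-s) (by linarith)
    rw [intervalIntegral.integral_comp_neg, intervalIntegral.integral_symm, norm_neg, abs_neg] at h2
    simpa using h2

variable {E : Type*} [NormedAddCommGroup E] [NormedSpace ℝ E]

/-- `d + Ω` is flat on `D`: `dΩ + Ω ∧ Ω = 0`, for a 1-form `Ω` with values in a normed algebra. -/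
def FlatWithin (Ω : E → E →L[ℝ] 𝔸) (D : Set E) : Prop :=
  ∀ u ∈ D, ∀ a b : E, fderivWithin ℝ Ω D u a b - fderivWithin ℝ Ω D u b a
    + (Ω u a * Ω u b - Ω u b * Ω u a) = 0

/-- `dG = G Ω` on `D`. -/
def IsPrimitiveWithin (G : E → 𝔸) (Ω : E → E →L[ℝ] 𝔸) (D : Set E) : Prop :=
  ∀ u ∈ D, HasFDerivWithinAt G (ContinuousLinearMap.mul ℝ 𝔸 (G u) ∘L Ω u) D u

/-- First-order variation of the solution `Y` of `Y' = Y Ω` along the segment from `u₀` to `u`,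
when the endpoint moves to `u'`. The curve `Y (1 + s Ω(u' - u))` solves the equation along the
segment to `u'` up to an error of second order, and this is where flatness enters. -/
theorem norm_parallel_transport_sub_le {D : Set E} (hD : Convex ℝ D)
    {Ω : E → E →L[ℝ] 𝔸} (hΩ : DifferentiableOn ℝ Ω D) (hflat : FlatWithin Ω D)
    {u₀ u u' : E} (h₀ : u₀ ∈ D) (hu : u ∈ D)
    {Y Y' : ℝ → 𝔸} (hY0 : Y 0 = 1) (hY0' : Y' 0 = 1)
    (hY : ∀ s ∈ Icc (0 : ℝ) 1, HasDerivAt Y (Y s * Ω (u₀ + s • (u - u₀)) (u - u₀)) s)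
    (hY' : ∀ s ∈ Icc (0 : ℝ) 1, HasDerivAt Y' (Y' s * Ω (u₀ + s • (u' - u₀)) (u' - u₀)) s)
    {M₀ M₁ L N My : ℝ} (hL0 : 0 ≤ L) (hM00 : 0 ≤ M₀) (hM10 : 0 ≤ M₁)
    (hM0 : ∀ s ∈ Icc (0 : ℝ) 1, ‖Ω (u₀ + s • (u - u₀))‖ ≤ M₀)
    (hM0' : ∀ s ∈ Icc (0 : ℝ) 1, ‖Ω (u₀ + s • (u' - u₀))‖ ≤ M₀)
    (hM1 : ∀ s ∈ Icc (0 : ℝ) 1, ‖fderivWithin ℝ Ω D (u₀ + s • (u - u₀))‖ ≤ M₁)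
    (hL : ∀ s ∈ Icc (0 : ℝ) 1, ‖Ω (u₀ + s • (u' - u₀)) - Ω (u₀ + s • (u - u₀))
      - fderivWithin ℝ Ω D (u₀ + s • (u - u₀)) (s • (u' - u))‖ ≤ L * ‖u' - u‖ ^ 2)
    (hN : ‖u - u₀‖ ≤ N) (hd : ‖u' - u‖ ≤ 1) (hMy : ∀ s ∈ Icc (0 : ℝ) 1, ‖Y s‖ ≤ My) :
    ‖Y' 1 - Y 1 - Y 1 * Ω u (u' - u)‖ ≤ gronwallBound 0 (M₀ * (N + 1))
      (My * ((M₁ + L * (N + 1) + M₀ * ((M₁ + L) * (N + 1) + M₀)) * ‖u' - u‖ ^ 2)) 1 := by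
  set e := u - u₀ with he
  set δ := u' - u with hδ
  have heδ : u' - u₀ = e + δ := by simp [he, hδ]
  simp only [heδ] at hY' hM0' hL
  have hMy0 : 0 ≤ My := (norm_nonneg _).trans (hMy 0 (by simp))
  have hN0 : 0 ≤ N := (norm_nonneg _).trans hN
  have hmem : ∀ s ∈ Icc (0 : ℝ) 1, u₀ + s • e ∈ D := fun s hs => by
    have := hD.add_smul_sub_mem h₀ hu hs
    simpa [he] using this
  have hnd : ‖δ‖ ^ 2 ≤ ‖δ‖ := by nlinarith [norm_nonneg δ]
  have hned : ‖e + δ‖ ≤ N + 1 := (norm_add_le _ _).trans (add_le_add hN hd)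
  -- the comparison curve and its derivative
  let Z : ℝ → 𝔸 := fun s => Y s * (1 + s • Ω (u₀ + s • e) δ)
  have hΩd : ∀ s ∈ Icc (0 : ℝ) 1, HasDerivWithinAt (fun s => Ω (u₀ + s • e) δ)
      (fderivWithin ℝ Ω D (u₀ + s • e) e δ) (Icc 0 1) s := by
    intro s hs
    have h1 : HasDerivWithinAt (fun s : ℝ => u₀ + s • e) e (Icc 0 1) s := by
      have := ((hasDerivAt_id s).smul_const e).const_add u₀
      simpa using this.hasDerivWithinAt
    have h2 := ((hΩ _ (hmem s hs)).hasFDerivWithinAt).comp_hasDerivWithinAt s h1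
      (fun t ht => hmem t ht)
    have h3 := ((ContinuousLinearMap.apply ℝ 𝔸 δ).hasFDerivAt).comp_hasDerivWithinAt s h2
    exact h3
  have hZ : ∀ s ∈ Icc (0 : ℝ) 1, HasDerivWithinAt Z
      (Y s * Ω (u₀ + s • e) e * (1 + s • Ω (u₀ + s • e) δ)
        + Y s * (s • fderivWithin ℝ Ω D (u₀ + s • e) e δ + Ω (u₀ + s • e) δ)) (Icc 0 1) s := by
    intro s hs
    have h1 := ((hasDerivAt_id s).hasDerivWithinAt (s := Icc (0:ℝ) 1)).smul (hΩd s hs)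
    have h2 := (hY s hs).hasDerivWithinAt (s := Icc (0:ℝ) 1) |>.mul (h1.const_add 1)
    refine h2.congr_deriv ?_
    simp
  have hT : ∀ s ∈ Icc (0 : ℝ) 1, HasDerivWithinAt (fun s => Y' s - Z s) _ (Icc 0 1) s :=
    fun s hs => (hY' s hs).hasDerivWithinAt.sub (hZ s hs)
  have hfin := norm_le_gronwallBound_of_norm_deriv_right_le (δ := 0) (K := M₀ * (N + 1))
    (ε := My * ((M₁ + L * (N + 1) + M₀ * ((M₁ + L) * (N + 1) + M₀)) * ‖δ‖ ^ 2))
    (fun s hs => (hT s hs).continuousWithinAt)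
    (fun s hs => (hT s (Ico_subset_Icc_self hs)).mono_of_mem_nhdsWithin
      (Icc_mem_nhdsGE_of_mem hs)) (by simp [Z, hY0, hY0']) ?_ 1 (by simp)
  · have h1 : Y' 1 - Z 1 = Y' 1 - Y 1 - Y 1 * Ω u δ := by
      simp only [Z, one_smul, he, add_sub_cancel, mul_add, mul_one]
      abel
    rw [h1] at hfin
    simpa using hfin
  intro s hs'
  have hs : s ∈ Icc (0 : ℝ) 1 := Ico_subset_Icc_self hs'
  have hs0 : ‖s‖ ≤ 1 := by rw [Real.norm_eq_abs, abs_of_nonneg hs.1]; exact hs.2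
  have hfl := hflat _ (hmem s hs) δ e
  have hLs := hL s hs
  have hM0s := hM0 s hs
  have hM1s := hM1 s hs
  have hM0s' := hM0' s hs
  set W := Ω (u₀ + s • e)
  set W' := Ω (u₀ + s • (e + δ))
  set DW := fderivWithin ℝ Ω D (u₀ + s • e)
  set r := W' - W - DW (s • δ) with hr
  have hW' : W' = W + s • DW δ + r := by rw [hr, map_smul]; abel
  have hkey : Y' s * W' (e + δ) - (Y s * W e * (1 + s • W δ) + Y s * (s • DW e δ + W δ))
      = (Y' s - Z s) * W' (e + δ)
        + Y s * (s • DW δ δ + r (e + δ) + s • (W δ * ((s • DW δ + r) (e + δ) + W δ))) := by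
    have h1 : W δ * W e = W e * W δ - DW δ e + DW e δ := by
      rw [← sub_eq_zero, ← hfl]; abel
    have h2 : W' (e + δ) = W e + W δ + (s • DW δ + r) (e + δ) := by
      rw [hW']; simp only [add_apply, map_add]; abel
    have h3 : (s • DW δ + r) (e + δ) = s • DW δ e + s • DW δ δ + r (e + δ) := by
      simp only [add_apply, smul_apply, map_add]; abel
    have h4 : Z s = Y s * (1 + s • W δ) := rfl
    rw [h4, h2, h3]
    generalize r (e + δ) = r'
    simp only [mul_add, add_mul, sub_mul, mul_sub, mul_one, smul_mul_assoc,
      mul_smul_comm, smul_add, smul_sub, mul_assoc, h1]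
    abel
  have hWδ : ‖W δ‖ ≤ M₀ * ‖δ‖ := W.le_of_opNorm_le hM0s δ
  have hDWδ : ‖DW δ‖ ≤ M₁ * ‖δ‖ := DW.le_of_opNorm_le hM1s δ
  have hb1 : ‖s • DW δ δ‖ ≤ M₁ * ‖δ‖ ^ 2 := by
    rw [norm_smul]
    calc _ ≤ 1 * (M₁ * ‖δ‖ * ‖δ‖) := by
          gcongr
          exact (DW δ).le_of_opNorm_le hDWδ δ
      _ = _ := by ring
  have hb2 : ‖r (e + δ)‖ ≤ L * (N + 1) * ‖δ‖ ^ 2 := by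
    calc _ ≤ (L * ‖δ‖ ^ 2) * ‖e + δ‖ := r.le_of_opNorm_le hLs _
      _ ≤ (L * ‖δ‖ ^ 2) * (N + 1) := by gcongr
      _ = _ := by ring
  have hb3 : ‖(s • DW δ + r) (e + δ)‖ ≤ (M₁ + L) * (N + 1) * ‖δ‖ := by
    have h1 : ‖s • DW δ + r‖ ≤ (M₁ + L) * ‖δ‖ := by
      calc _ ≤ ‖s • DW δ‖ + ‖r‖ := norm_add_le _ _
        _ ≤ 1 * (M₁ * ‖δ‖) + L * ‖δ‖ := by
          gcongr
          · rw [norm_smul]; gcongr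
          · exact hLs.trans (by gcongr)
        _ = _ := by ring
    calc _ ≤ ((M₁ + L) * ‖δ‖) * ‖e + δ‖ := ContinuousLinearMap.le_of_opNorm_le _ h1 _
      _ ≤ ((M₁ + L) * ‖δ‖) * (N + 1) := by gcongr
      _ = _ := by ring
  have hb4 : ‖s • (W δ * ((s • DW δ + r) (e + δ) + W δ))‖
      ≤ M₀ * ((M₁ + L) * (N + 1) + M₀) * ‖δ‖ ^ 2 := by
    rw [norm_smul]
    calc _ ≤ 1 * (M₀ * ‖δ‖ * ((M₁ + L) * (N + 1) * ‖δ‖ + M₀ * ‖δ‖)) := by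
          gcongr
          refine (norm_mul_le _ _).trans ?_
          gcongr
          exact (norm_add_le _ _).trans (add_le_add hb3 hWδ)
      _ = _ := by ring
  have hb5 : ‖W' (e + δ)‖ ≤ M₀ * (N + 1) :=
    (W'.le_of_opNorm_le hM0s' _).trans (by gcongr)
  rw [hkey]
  refine (norm_add_le _ _).trans (add_le_add ?_ ?_)
  · refine (norm_mul_le _ _).trans ?_
    rw [mul_comm]
    gcongr
  · refine (norm_mul_le _ _).trans ?_
    gcongr
    · exact hMy s hs
    · refine (norm_add₃_le).trans ?_
      linarith

/-- The equation `dG = G Ω` gains one derivative at a time. -/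
theorem IsPrimitiveWithin.contDiffOn {G : E → 𝔸} {Ω : E → E →L[ℝ] 𝔸} {D : Set E}
    (hG : IsPrimitiveWithin G Ω D) (hΩ : ContDiffOn ℝ ∞ Ω D) : ContDiffOn ℝ ∞ G D := by
  rw [contDiffOn_infty]
  intro n
  induction n with
  | zero => exact contDiffOn_zero.2 fun u hu => (hG u hu).continuousWithinAt
  | succ n ih =>
    rw [Nat.cast_succ, contDiffOn_succ_iff_hasFDerivWithinAt (by simp)]
    intro u hu
    refine ⟨D, by rw [insert_eq_of_mem hu]; exact self_mem_nhdsWithin, by simp, _, hG, ?_⟩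
    exact ((ContinuousLinearMap.mul ℝ 𝔸).contDiff.comp_contDiffOn ih).clm_comp
      (hΩ.of_le (by exact_mod_cast le_top))

variable {E' : Type*} [NormedAddCommGroup E'] [NormedSpace ℝ E']

set_option maxSynthPendingDepth 3 in
/-- Flatness is preserved by pullback, because second derivatives are symmetric. -/
theorem FlatWithin.pullback {D : Set E'} {S : Set E} (hDu : UniqueDiffOn ℝ D)
    (hDi : D ⊆ closure (interior D)) {h : E' → E} (hh : ContDiffOn ℝ 2 h D) (hm : MapsTo h D S)
    {Ω : E → E →L[ℝ] 𝔸} (hΩ : DifferentiableOn ℝ Ω S) (hflat : FlatWithin Ω S) :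
    FlatWithin (fun u => Ω (h u) ∘L fderivWithin ℝ h D u) D := by
  intro u hu a b
  have h1 : HasFDerivWithinAt h (fderivWithin ℝ h D u) D u :=
    (hh.differentiableOn (by norm_num) u hu).hasFDerivWithinAt
  have h2 : HasFDerivWithinAt (fderivWithin ℝ h D) (fderivWithin ℝ (fderivWithin ℝ h D) D u) D u :=
    ((hh.fderivWithin hDu (m := 1) (by norm_num)).differentiableOn (by norm_num) u
      hu).hasFDerivWithinAt
  have h3 := ((hΩ _ (hm hu)).hasFDerivWithinAt).comp u h1 hm
  have h4 := h3.clm_comp h2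
  have hsym : fderivWithin ℝ (fderivWithin ℝ h D) D u a b
      = fderivWithin ℝ (fderivWithin ℝ h D) D u b a :=
    ((hh u hu).isSymmSndFDerivWithinAt (by simp) hDu (hDi hu) hu).eq a b
  have h5 := h4.fderivWithin (hDu u hu)
  simp only [Function.comp_def] at h5
  rw [h5]
  have h6 := hflat _ (hm hu) (fderivWithin ℝ h D u a) (fderivWithin ℝ h D u b)
  rw [← h6]
  simp [hsym]

variable [CompleteSpace 𝔸]

/-- The solution is the sum of the iterated integrals of the coefficient. -/
theorem exists_linear_ode_solution {a : ℝ → 𝔸} (ha : Continuous a) {M : ℝ} (hM : ∀ s, ‖a s‖ ≤ M) :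
    ∃ Y : ℝ → 𝔸, Y 0 = 1 ∧ ∀ s ∈ Icc (0 : ℝ) 1, HasDerivAt Y (Y s * a s) s := by
  have hM0 : 0 ≤ M := (norm_nonneg _).trans (hM 0)
  let y : ℕ → ℝ → 𝔸 := fun n =>
    Nat.rec (fun _ => 1) (fun _ g s => ∫ x in (0 : ℝ)..s, g x * a x) n
  have y0 : ∀ s, y 0 s = 1 := fun s => rfl
  have ys : ∀ n s, y (n + 1) s = ∫ x in (0 : ℝ)..s, y n x * a x := fun n s => rfl
  have hcont : ∀ n, Continuous (y n) := by
    intro n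
    induction n with
    | zero => exact continuous_const
    | succ n ih =>
      have : y (n + 1) = fun s => ∫ x in (0 : ℝ)..s, y n x * a x := rfl
      rw [this]
      exact intervalIntegral.continuous_primitive
        (fun _ _ => (ih.mul ha).intervalIntegrable _ _) 0
  have hder : ∀ n s, HasDerivAt (y (n + 1)) (y n s * a s) s := fun n s =>
    intervalIntegral.integral_hasDerivAt_right (((hcont n).mul ha).intervalIntegrable _ _)
      (((hcont n).mul ha).stronglyMeasurableAtFilter _ _) ((hcont n).mul ha).continuousAt
  have hbound : ∀ n s, ‖y n s‖ ≤ ‖(1 : 𝔸)‖ * M ^ n / n.factorial * |s| ^ n := by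
    intro n
    induction n with
    | zero => intro s; simp [y0]
    | succ n ih =>
      intro s
      rw [ys]
      refine (norm_intervalIntegral_zero_le_pow (c := ‖(1 : 𝔸)‖ * M ^ n / n.factorial * M)
        (n := n) (fun x => ?_) s).trans (le_of_eq ?_)
      · calc ‖y n x * a x‖ ≤ ‖y n x‖ * ‖a x‖ := norm_mul_le _ _
          _ ≤ (‖(1 : 𝔸)‖ * M ^ n / n.factorial * |x| ^ n) * M := by
            gcongr
            · exact ih x
            · exact hM x
          _ = _ := by ring
      · rw [Nat.factorial_succ]
        push_cast
        field_simp
        ring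
  have hbound2 : ∀ n, ∀ s ∈ Ioo (-2 : ℝ) 2, ‖y n s‖ ≤ ‖(1 : 𝔸)‖ * ((M * 2) ^ n / n.factorial) := by
    intro n s hs
    refine (hbound n s).trans ?_
    have : |s| ≤ 2 := abs_le.2 ⟨hs.1.le, hs.2.le⟩
    calc _ ≤ ‖(1 : 𝔸)‖ * M ^ n / n.factorial * 2 ^ n := by gcongr
      _ = _ := by rw [mul_pow]; ring
  have hsum : Summable fun n : ℕ => ‖(1 : 𝔸)‖ * ((M * 2) ^ n / n.factorial) :=
    (Real.summable_pow_div_factorial _).mul_left _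
  have hsumy : ∀ s ∈ Ioo (-2 : ℝ) 2, Summable fun n => y n s := fun s hs =>
    Summable.of_norm_bounded hsum fun n => hbound2 n s hs
  have hz : (0 : ℝ) ∈ Ioo (-2 : ℝ) 2 := by norm_num
  have hy0 : ∀ n, y (n + 1) 0 = 0 := fun n => by rw [ys]; simp
  refine ⟨fun s => 1 + ∑' n, y (n + 1) s, by simp [hy0], fun s hs => ?_⟩
  have hs' : s ∈ Ioo (-2 : ℝ) 2 := ⟨by linarith [hs.1], by linarith [hs.2]⟩
  have hd := hasDerivAt_tsum_of_isPreconnected (g := fun n => y (n + 1))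
    (g' := fun n s => y n s * a s) (hsum.mul_right M) isOpen_Ioo isPreconnected_Ioo
    (fun n s _ => hder n s)
    (fun n s hs => (norm_mul_le _ _).trans
      (mul_le_mul (hbound2 n s hs) (hM s) (norm_nonneg _)
        ((norm_nonneg _).trans (hbound2 n s hs)))) hz (by simp [hy0]) hs'
  have he : (∑' n, y n s * a s) = (1 + ∑' n, y (n + 1) s) * a s := by
    rw [(hsumy s hs').tsum_mul_right, (hsumy s hs').tsum_eq_zero_add, y0]
  rw [← he]
  exact hd.const_add _

theorem exists_linear_ode_solution_of_continuousOn {a : ℝ → 𝔸} (ha : ContinuousOn a (Icc 0 1)) :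
    ∃ Y : ℝ → 𝔸, Y 0 = 1 ∧ ∀ s ∈ Icc (0 : ℝ) 1, HasDerivAt Y (Y s * a s) s := by
  obtain ⟨M, hM⟩ := isCompact_Icc.exists_bound_of_continuousOn ha
  obtain ⟨Y, h0, hY⟩ := exists_linear_ode_solution (a := IccExtend zero_le_one ((Icc 0 1).domRestrict a))
    (ha.domRestrict.Icc_extend') (M := M) (fun s => hM _ (projIcc 0 1 zero_le_one s).2)
  refine ⟨Y, h0, fun s hs => ?_⟩
  have := hY s hs
  rwa [IccExtend_of_mem _ _ hs] at this

set_option maxSynthPendingDepth 3 in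
/-- A flat form on a closed convex set has a primitive. -/
theorem exists_isPrimitiveWithin_of_flatWithin [ProperSpace E] {D : Set E} (hD : Convex ℝ D)
    (hDc : IsClosed D) (hDu : UniqueDiffOn ℝ D) {Ω : E → E →L[ℝ] 𝔸} (hΩ : ContDiffOn ℝ 2 Ω D)
    (hflat : FlatWithin Ω D) {u₀ : E} (h₀ : u₀ ∈ D) :
    ∃ G : E → 𝔸, G u₀ = 1 ∧ IsPrimitiveWithin G Ω D := by
  have hmem : ∀ u ∈ D, ∀ s ∈ Icc (0 : ℝ) 1, u₀ + s • (u - u₀) ∈ D := fun u hu s hs =>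
    hD.add_smul_sub_mem h₀ hu hs
  have hex : ∀ u, ∃ Y : ℝ → 𝔸, u ∈ D → Y 0 = 1 ∧
      ∀ s ∈ Icc (0 : ℝ) 1, HasDerivAt Y (Y s * Ω (u₀ + s • (u - u₀)) (u - u₀)) s := by
    intro u
    by_cases hu : u ∈ D
    · obtain ⟨Y, hY⟩ := exists_linear_ode_solution_of_continuousOn
        (a := fun s : ℝ => Ω (u₀ + s • (u - u₀)) (u - u₀))
        ((hΩ.continuousOn.comp (by fun_prop) (fun s hs => hmem u hu s hs)).clm_apply
          continuousOn_const)
      exact ⟨Y, fun _ => hY⟩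
    · exact ⟨0, fun h => absurd h hu⟩
  choose Y hY using hex
  refine ⟨fun u => Y u 1, ?_, fun u hu => ?_⟩
  · have h := (hY u₀ h₀).2
    have hc : ∀ s ∈ Icc (0 : ℝ) 1, Y u₀ s = Y u₀ 0 := by
      refine constant_of_has_deriv_right_zero
        (fun s hs => (h s hs).continuousAt.continuousWithinAt) fun s hs => ?_
      simpa using (h s (Ico_subset_Icc_self hs)).hasDerivWithinAt (s := Ici s)
    exact (hc 1 (by simp)).trans (hY u₀ h₀).1
  -- uniform bounds on a compact convex neighbourhood of the segment
  set N := ‖u - u₀‖ with hN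
  let Kc : Set E := D ∩ Metric.closedBall u₀ (N + 1)
  have hKc : IsCompact Kc := (isCompact_closedBall _ _).inter_left hDc
  have hKv : Convex ℝ Kc := hD.inter (convex_closedBall _ _)
  have hKD : Kc ⊆ D := inter_subset_left
  have h₀K : u₀ ∈ Kc := ⟨h₀, by simp only [Metric.mem_closedBall, dist_self]; positivity⟩
  have huK : u ∈ Kc := ⟨hu, by simp [dist_eq_norm, hN]⟩
  have hΩ' : ContDiffOn ℝ 1 (fderivWithin ℝ Ω D) D := hΩ.fderivWithin hDu (by norm_num)
  have hΩ'' : ContinuousOn (fderivWithin ℝ (fderivWithin ℝ Ω D) D) D :=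
    hΩ'.continuousOn_fderivWithin hDu (by norm_num)
  have hdiff : DifferentiableOn ℝ Ω D := hΩ.differentiableOn (by norm_num)
  have hdiff' : DifferentiableOn ℝ (fderivWithin ℝ Ω D) D := hΩ'.differentiableOn (by norm_num)
  obtain ⟨M₀, hM₀⟩ := hKc.exists_bound_of_continuousOn (hΩ.continuousOn.mono hKD)
  obtain ⟨M₁, hM₁⟩ := hKc.exists_bound_of_continuousOn (hΩ'.continuousOn.mono hKD)
  obtain ⟨L, hL⟩ := hKc.exists_bound_of_continuousOn (hΩ''.mono hKD)
  have hM₀0 : 0 ≤ M₀ := (norm_nonneg _).trans (hM₀ _ h₀K)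
  have hM₁0 : 0 ≤ M₁ := (norm_nonneg _).trans (hM₁ _ h₀K)
  have hL0 : 0 ≤ L := (norm_nonneg _).trans (hL _ h₀K)
  have hlip : ∀ x ∈ Kc, ∀ y ∈ Kc, ‖fderivWithin ℝ Ω D y - fderivWithin ℝ Ω D x‖ ≤ L * ‖y - x‖ :=
    fun x hx y hy => hKv.norm_image_sub_le_of_norm_hasFDerivWithin_le
      (fun z hz => ((hdiff' z (hKD hz)).hasFDerivWithinAt).mono hKD) hL hx hy
  have htaylor : ∀ x ∈ Kc, ∀ y ∈ Kc,
      ‖Ω y - Ω x - fderivWithin ℝ Ω D x (y - x)‖ ≤ L * ‖y - x‖ ^ 2 := by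
    intro x hx y hy
    have hseg : segment ℝ x y ⊆ Kc := hKv.segment_subset hx hy
    have := (convex_segment x y).norm_image_sub_le_of_norm_hasFDerivWithin_le'
      (f := Ω) (f' := fderivWithin ℝ Ω D) (φ := fderivWithin ℝ Ω D x) (C := L * ‖y - x‖)
      (fun z hz => ((hdiff z (hKD (hseg hz))).hasFDerivWithinAt).mono (hseg.trans hKD))
      (fun z hz => (hlip x hx z (hseg hz)).trans (by gcongr; exact norm_sub_le_of_mem_segment hz))
      (left_mem_segment ℝ x y) (right_mem_segment ℝ x y)
    exact this.trans (le_of_eq (by ring))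
  obtain ⟨My, hMy⟩ := isCompact_Icc.exists_bound_of_continuousOn (s := Icc (0 : ℝ) 1)
    (f := Y u) fun s hs => ((hY u hu).2 s hs).continuousAt.continuousWithinAt
  have hMy0 : 0 ≤ My := (norm_nonneg _).trans (hMy 0 (by simp))
  set c := M₁ + L * (N + 1) + M₀ * ((M₁ + L) * (N + 1) + M₀)
  have hest : ∀ u' ∈ D, ‖u' - u‖ ≤ 1 → ‖Y u' 1 - Y u 1 - Y u 1 * Ω u (u' - u)‖
      ≤ gronwallBound 0 (M₀ * (N + 1)) (My * c) 1 * ‖u' - u‖ ^ 2 := by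
    intro u' hu' hd
    have hu'K : u' ∈ Kc := ⟨hu', by
      rw [Metric.mem_closedBall, dist_eq_norm, ← sub_add_sub_cancel u' u u₀]
      refine (norm_add_le _ _).trans ?_
      linarith⟩
    have hsK : ∀ v ∈ Kc, ∀ s ∈ Icc (0 : ℝ) 1, u₀ + s • (v - u₀) ∈ Kc :=
      fun v hv s hs => hKv.add_smul_sub_mem h₀K hv hs
    have := norm_parallel_transport_sub_le hD hdiff hflat h₀ hu (hY u hu).1 (hY u' hu').1
      (hY u hu).2 (hY u' hu').2 hL0 hM₀0 hM₁0 (fun s hs => hM₀ _ (hsK u huK s hs))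
      (fun s hs => hM₀ _ (hsK u' hu'K s hs)) (fun s hs => hM₁ _ (hsK u huK s hs))
      (fun s hs => ?_) le_rfl hd hMy
    · refine this.trans (le_of_eq ?_)
      unfold gronwallBound
      split_ifs <;> ring
    · have h1 := htaylor _ (hsK u huK s hs) _ (hsK u' hu'K s hs)
      have h2 : u₀ + s • (u' - u₀) - (u₀ + s • (u - u₀)) = s • (u' - u) := by
        rw [add_sub_add_left_eq_sub, ← smul_sub, sub_sub_sub_cancel_right]
      rw [h2] at h1
      refine h1.trans ?_
      rw [norm_smul, Real.norm_eq_abs, abs_of_nonneg hs.1]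
      have h3 : 0 ≤ s * ‖u' - u‖ := mul_nonneg hs.1 (norm_nonneg _)
      gcongr
      exact mul_le_of_le_one_left (norm_nonneg _) hs.2
  refine .of_isLittleO ?_
  have hO : (fun u' => Y u' 1 - Y u 1 - (ContinuousLinearMap.mul ℝ 𝔸 (Y u 1) ∘L Ω u) (u' - u))
      =O[𝓝[D] u] fun u' => ‖u' - u‖ ^ 2 := by
    refine .of_bound (gronwallBound 0 (M₀ * (N + 1)) (My * c) 1) ?_
    filter_upwards [self_mem_nhdsWithin,
      mem_nhdsWithin_of_mem_nhds (Metric.closedBall_mem_nhds u one_pos)] with u' hu' hb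
    rw [Metric.mem_closedBall, dist_eq_norm] at hb
    simpa using hest u' hu' hb
  refine hO.trans_isLittleO ?_
  have h1 : Tendsto (fun u' : E => u' - u) (𝓝[D] u) (𝓝 0) := by
    have : ContinuousAt (fun u' : E => u' - u) u := by fun_prop
    simpa [ContinuousAt] using this.tendsto.mono_left nhdsWithin_le_nhds
  have h2 : (fun x : E => ‖x‖ ^ 2) =o[𝓝 0] fun x => x := Asymptotics.isLittleO_norm_pow_id one_lt_two
  exact h2.comp_tendsto h1

end FlatForms

/-! ### The universal cover is diffeomorphic to a closed half-plane -/

section HalfPlane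

/-- The disc automorphism `z ↦ (z + c) / (1 + c̄ z)`. -/
noncomputable def moebius (c z : ℂ) : ℂ := (z + c) / (1 + (starRingEnd ℂ) c * z)

theorem one_add_conj_mul_ne_zero {c z : ℂ} (hc : ‖c‖ < 1) (hz : ‖z‖ ≤ 1) :
    1 + (starRingEnd ℂ) c * z ≠ 0 := by
  intro h
  have h1 : (starRingEnd ℂ) c * z = -1 := by linear_combination h
  have h2 : ‖c‖ * ‖z‖ = 1 := by
    rw [← Complex.norm_conj c, ← norm_mul, h1]; simp
  nlinarith [norm_nonneg c, norm_nonneg z]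

theorem norm_moebius_le {c z : ℂ} (hc : ‖c‖ < 1) (hz : ‖z‖ ≤ 1) : ‖moebius c z‖ ≤ 1 := by
  have h0 := one_add_conj_mul_ne_zero hc hz
  rw [moebius, norm_div, div_le_one (norm_pos_iff.2 h0), ← sq_le_sq₀ (norm_nonneg _) (norm_nonneg _)]
  have h1 : ‖c‖ ^ 2 ≤ 1 := by nlinarith [norm_nonneg c]
  have h2 : ‖z‖ ^ 2 ≤ 1 := by nlinarith [norm_nonneg z]
  rw [Complex.sq_norm, Complex.normSq_apply] at *
  rw [Complex.sq_norm, Complex.normSq_apply] at *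
  simp
  nlinarith [mul_nonneg (sub_nonneg.2 h1) (sub_nonneg.2 h2)]

theorem moebius_neg_moebius {c z : ℂ} (hc : ‖c‖ < 1) (hz : ‖z‖ ≤ 1) :
    moebius (-c) (moebius c z) = z := by
  have h0 := one_add_conj_mul_ne_zero hc hz
  have h2 := one_add_conj_mul_ne_zero (c := -c) (by simpa using hc) (norm_moebius_le hc hz)
  have h3 : moebius c z * (1 + (starRingEnd ℂ) c * z) = z + c := div_mul_cancel₀ _ h0
  rw [moebius, div_eq_iff h2, map_neg]
  refine mul_right_cancel₀ h0 ?_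
  linear_combination (1 + (starRingEnd ℂ) c * z) * h3

theorem contDiffOn_moebius {c : ℂ} (hc : ‖c‖ < 1) :
    ContDiffOn ℝ ∞ (moebius c) (Metric.closedBall 0 1) := by
  have h1 : ContDiff ℝ ∞ fun z : ℂ => z + c := by fun_prop
  have h2 : ContDiff ℝ ∞ fun z : ℂ => 1 + (starRingEnd ℂ) c * z := by fun_prop
  refine h1.contDiffOn.mul (h2.contDiffOn.inv fun z hz => ?_)
  exact one_add_conj_mul_ne_zero hc (by simpa using hz)

/-- A diffeomorphism of `Δ` to the closed disc maps interior points to interior points, because it is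
an open map there. -/
theorem mem_ball_of_leftInverse_of_mem_interior {Δ : Set ℂ} {f g : ℂ → ℂ}
    (hf : ContDiffOn ℝ ∞ f (Metric.closedBall 0 1)) (hg : ContDiffOn ℝ ∞ g Δ)
    (hgm : MapsTo g Δ (Metric.closedBall 0 1)) (hfg : ∀ z ∈ Δ, f (g z) = z) {z : ℂ}
    (hz : z ∈ interior Δ) : ‖g z‖ < 1 := by
  have hΔ : Δ ∈ 𝓝 z := mem_interior_iff_mem_nhds.1 hz
  have hgz : ContDiffAt ℝ ∞ g z := hg.contDiffAt hΔ
  have h1 : HasStrictFDerivAt g (fderiv ℝ g z) z := hgz.hasStrictFDerivAt (by simp)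
  have h2 : HasFDerivWithinAt f (fderivWithin ℝ f (Metric.closedBall 0 1) (g z))
      (Metric.closedBall 0 1) (g z) :=
    (hf.differentiableOn (by simp) _ (hgm (interior_subset hz))).hasFDerivWithinAt
  have h3 : HasFDerivAt (f ∘ g) (fderivWithin ℝ f (Metric.closedBall 0 1) (g z) ∘L fderiv ℝ g z) z :=
    (h2.comp z h1.hasFDerivAt.hasFDerivWithinAt hgm).hasFDerivAt hΔ
  have h4 : HasFDerivAt (f ∘ g) (ContinuousLinearMap.id ℝ ℂ) z :=
    (hasFDerivAt_id z).congr_of_eventuallyEq (by filter_upwards [hΔ] with w hw using hfg w hw)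
  have h5 := h3.unique h4
  have hinj : Function.Injective (fderiv ℝ g z) := fun a b hab => by
    have := congrArg (fun T : ℂ →L[ℝ] ℂ => T a) h5
    have h' := congrArg (fun T : ℂ →L[ℝ] ℂ => T b) h5
    simp only [ContinuousLinearMap.comp_apply, hab] at this h'
    exact this.symm.trans h'
  have hsurj : (fderiv ℝ g z).range = ⊤ :=
    LinearMap.range_eq_top.2 (LinearMap.surjective_of_injective (f := (fderiv ℝ g z).toLinearMap) hinj)
  have h6 := h1.map_nhds_eq_of_surj hsurj
  have h7 : Metric.closedBall (0 : ℂ) 1 ∈ 𝓝 (g z) := by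
    rw [← h6]
    exact Filter.mem_map.2 (mem_of_superset hΔ hgm)
  have h8 := mem_interior_iff_mem_nhds.2 h7
  rw [interior_closedBall _ one_ne_zero] at h8
  simpa using h8

/-- `F` is a diffeomorphism from the closed unit disc to `Δ`, with inverse `g`, which fixes `0`. -/
structure IsCenteredChart (Δ : Set ℂ) (F g : ℂ → ℂ) : Prop where
  contDiffOn : ContDiffOn ℝ ∞ F (Metric.closedBall 0 1)
  contDiffOn_inv : ContDiffOn ℝ ∞ g Δ
  mapsTo : MapsTo F (Metric.closedBall 0 1) Δ
  mapsTo_inv : MapsTo g Δ (Metric.closedBall 0 1)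
  leftInv : ∀ z ∈ Metric.closedBall (0 : ℂ) 1, g (F z) = z
  rightInv : ∀ z ∈ Δ, F (g z) = z
  map_zero : F 0 = 0

theorem IsDiscAroundZero.exists_isCenteredChart {Δ : Set ℂ} (hΔ : IsDiscAroundZero Δ) :
    ∃ F g : ℂ → ℂ, IsCenteredChart Δ F g := by
  obtain ⟨⟨f, g, hf, hg, himg, hgf⟩, h0⟩ := hΔ
  have hfm : MapsTo f (Metric.closedBall 0 1) Δ := fun z hz => himg ▸ mem_image_of_mem f hz
  have hgm : MapsTo g Δ (Metric.closedBall 0 1) := by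
    rw [← himg]
    rintro _ ⟨u, hu, rfl⟩
    rwa [hgf u hu]
  have hfg : ∀ z ∈ Δ, f (g z) = z := by
    rw [← himg]
    rintro _ ⟨u, hu, rfl⟩
    rw [hgf u hu]
  have hc : ‖g 0‖ < 1 := mem_ball_of_leftInverse_of_mem_interior hf hg hgm hfg h0
  have hc' : ‖-g 0‖ < 1 := by simpa using hc
  have hm : ∀ c : ℂ, ‖c‖ < 1 → MapsTo (moebius c) (Metric.closedBall 0 1) (Metric.closedBall 0 1) :=
    fun c hc z hz => by simpa using norm_moebius_le hc (by simpa using hz)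
  refine ⟨f ∘ moebius (g 0), moebius (-g 0) ∘ g,
    ⟨hf.comp (contDiffOn_moebius hc) (hm _ hc), (contDiffOn_moebius hc').comp hg hgm,
      hfm.comp (hm _ hc), (hm _ hc').comp hgm, fun z hz => ?_, fun z hz => ?_, ?_⟩⟩
  · simp only [Function.comp_apply]
    rw [hgf _ (hm _ hc hz), moebius_neg_moebius hc (by simpa using hz)]
  · simp only [Function.comp_apply]
    have := moebius_neg_moebius hc' (by simpa using hgm hz)
    rw [neg_neg] at this
    rw [this, hfg z hz]
  · simp [moebius, hfg 0 (interior_subset h0)]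

/-! #### Logarithms -/

theorem exists_continuous_log {Φ : ℂ → ℂ} (hΦ : Continuous Φ) (h0 : ∀ u, Φ u ≠ 0) :
    ∃ h : ℂ → ℂ, Continuous h ∧ ∀ u, Complex.exp (h u) = Φ u := by
  obtain ⟨L, ⟨-, hL⟩, -⟩ := Complex.isCoveringMap_exp.existsUnique_continuousMap_lifts
    (⟨fun u => ⟨Φ u, h0 u⟩, by fun_prop⟩ : C(ℂ, {z : ℂ // z ≠ 0})) 0 (Complex.log (Φ 0))
    (Subtype.ext (Complex.exp_log (h0 0)))
  exact ⟨L, L.continuous, fun u => congrArg Subtype.val (congrFun hL u)⟩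

theorem eqOn_of_exp_eqOn {S : Set ℂ} (hS : IsPreconnected S) {h k : ℂ → ℂ} (hh : ContinuousOn h S)
    (hk : ContinuousOn k S) (he : ∀ u ∈ S, Complex.exp (h u) = Complex.exp (k u)) {a : ℂ}
    (ha : a ∈ S) (hak : h a = k a) : EqOn h k S :=
  Complex.isCoveringMap_exp.eqOn_of_comp_eqOn hS hh hk (fun u hu => Subtype.ext (he u hu)) ha hak

theorem eventually_eq_add_log {S : Set ℂ} {φ : ℂ → ℂ} {x : ℂ} (hφ : ContinuousWithinAt φ S x) :
    ∀ᶠ u in 𝓝[S] x, φ u = φ x + Complex.log (Complex.exp (φ u) / Complex.exp (φ x)) := by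
  have h1 : ∀ᶠ u in 𝓝[S] x, dist (φ u) (φ x) < Real.pi := hφ.eventually
    (Metric.ball_mem_nhds (φ x) Real.pi_pos)
  filter_upwards [h1] with u hu
  rw [← Complex.exp_sub]
  have h2 := abs_lt.1 ((Complex.abs_im_le_norm (φ u - φ x)).trans_lt (by rwa [← dist_eq_norm]))
  rw [Complex.log_exp h2.1 h2.2.le]
  ring

/-- A continuous logarithm of a smooth function is smooth, within any set. -/
theorem contDiffWithinAt_of_exp {S : Set ℂ} {φ : ℂ → ℂ} {x : ℂ}
    (hφ : ContinuousWithinAt φ S x) (he : ContDiffWithinAt ℝ ∞ (fun u => Complex.exp (φ u)) S x) :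
    ContDiffWithinAt ℝ ∞ φ S x := by
  refine ContDiffWithinAt.congr_of_eventuallyEq (f := fun u =>
    φ x + Complex.log (Complex.exp (φ u) / Complex.exp (φ x))) ?_ (eventually_eq_add_log hφ)
    (by simp)
  refine contDiffWithinAt_const.add ?_
  refine ContDiffAt.comp_contDiffWithinAt x (g := Complex.log) ?_ (he.div_const _)
  rw [div_self (Complex.exp_ne_zero _)]
  exact (Complex.contDiffAt_log (by simp)).restrict_scalars ℝ

/-- The retraction of the plane onto the half-plane of the points of real part at most `a`. -/
noncomputable def toHalfPlane (a : ℝ) (u : ℂ) : ℂ := ⟨min u.re a, u.im⟩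

theorem continuous_toHalfPlane (a : ℝ) : Continuous (toHalfPlane a) := by
  have : toHalfPlane a = fun u => ((min u.re a : ℝ) : ℂ) + (u.im : ℂ) * Complex.I := by
    ext u; simp [toHalfPlane, Complex.ext_iff]
  rw [this]
  fun_prop

theorem toHalfPlane_of_le {a : ℝ} {u : ℂ} (h : u.re ≤ a) : toHalfPlane a u = u := by
  simp [toHalfPlane, h]

theorem toHalfPlane_re_le (a : ℝ) (u : ℂ) : (toHalfPlane a u).re ≤ a := min_le_right _ _

theorem toHalfPlane_add_period (a : ℝ) (u : ℂ) :
    toHalfPlane a (u + 2 * Real.pi * Complex.I) = toHalfPlane a u + 2 * Real.pi * Complex.I := by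
  simp [toHalfPlane, Complex.ext_iff]

theorem exp_add_period (u : ℂ) :
    Complex.exp (u + 2 * Real.pi * Complex.I) = Complex.exp u := by
  rw [Complex.exp_add, Complex.exp_two_pi_mul_I, mul_one]

/-- A logarithm of a periodic function changes over a period by a multiple of the period. -/
theorem exists_int_log_add_period {h : ℂ → ℂ} (hh : Continuous h)
    (hp : ∀ u, Complex.exp (h (u + 2 * Real.pi * Complex.I)) = Complex.exp (h u)) :
    ∃ N : ℤ, ∀ (u : ℂ) (j : ℤ), h (u + j * (2 * Real.pi * Complex.I))
      = h u + j * N * (2 * Real.pi * Complex.I) := by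
  obtain ⟨N, hN⟩ := Complex.exp_eq_exp_iff_exists_int.1 (hp 0)
  have h1 : ∀ u, h (u + 2 * Real.pi * Complex.I) = h u + N * (2 * Real.pi * Complex.I) := by
    intro u
    refine eqOn_of_exp_eqOn (h := fun u => h (u + 2 * Real.pi * Complex.I))
      (k := fun u => h u + N * (2 * Real.pi * Complex.I)) isPreconnected_univ
      (by fun_prop) (by fun_prop) (fun u _ => ?_) (mem_univ 0) hN (mem_univ u)
    rw [hp u, Complex.exp_add, Complex.exp_int_mul_two_pi_mul_I, mul_one]
  refine ⟨N, fun u j => ?_⟩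
  induction j with
  | zero => simp
  | succ j ih =>
    have : u + ((j : ℤ) + 1 : ℤ) * (2 * Real.pi * Complex.I)
        = (u + (j : ℤ) * (2 * Real.pi * Complex.I)) + 2 * Real.pi * Complex.I := by push_cast; ring
    rw [this, h1, ih]; push_cast; ring
  | pred j ih =>
    have h2 := h1 (u + (-(j : ℤ) - 1 : ℤ) * (2 * Real.pi * Complex.I))
    have : u + (-(j : ℤ) - 1 : ℤ) * (2 * Real.pi * Complex.I) + 2 * Real.pi * Complex.I
        = u + (-(j : ℤ) : ℤ) * (2 * Real.pi * Complex.I) := by push_cast; ring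
    rw [this, ih] at h2
    push_cast at h2 ⊢
    linear_combination -h2

/-! #### The chart of the universal cover -/

theorem norm_exp_le_of_re_le {u : ℂ} {ε : ℝ} (hε : 0 < ε) (h : u.re ≤ Real.log ε) :
    ‖Complex.exp u‖ ≤ ε := by
  rw [Complex.norm_exp]
  exact (Real.le_log_iff_exp_le hε).1 h

theorem exp_mem_closedBall {u : ℂ} (h : u.re ≤ 0) :
    Complex.exp u ∈ Metric.closedBall (0 : ℂ) 1 := by
  simpa using norm_exp_le_of_re_le one_pos (by simpa using h)

namespace IsCenteredChart

variable {Δ : Set ℂ} {F g : ℂ → ℂ}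

theorem inv_map_zero (hF : IsCenteredChart Δ F g) : g 0 = 0 := by
  have := hF.leftInv 0 (by simp)
  rwa [hF.map_zero] at this

theorem ne_zero (hF : IsCenteredChart Δ F g) {z : ℂ} (hz : z ∈ Metric.closedBall (0 : ℂ) 1)
    (h0 : z ≠ 0) : F z ≠ 0 := fun h => h0 <| by
  rw [← hF.leftInv z hz, h, hF.inv_map_zero]

theorem inv_ne_zero (hF : IsCenteredChart Δ F g) {z : ℂ} (hz : z ∈ Δ)
    (h0 : z ≠ 0) : g z ≠ 0 := fun h => h0 <| by
  rw [← hF.rightInv z hz, h, hF.map_zero]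

/-- The lift `h` of the chart to the universal covers increases the angle by one full turn, in
absolute value, over a full turn: near the branch point, the lift `k` of the inverse chart has
a winding number as well, and the two multiply to `1`. -/
theorem exists_log_period (hF : IsCenteredChart Δ F g) (h0 : (0 : ℂ) ∈ interior Δ) {h : ℂ → ℂ}
    (hh : Continuous h) (he : ∀ u, Complex.exp (h u) = F (Complex.exp (toHalfPlane 0 u))) :
    ∃ N : ℤ, N * N = 1 ∧ ∀ (u : ℂ) (j : ℤ), h (u + j * (2 * Real.pi * Complex.I))
      = h u + j * N * (2 * Real.pi * Complex.I) := by
  obtain ⟨N, hN⟩ := exists_int_log_add_period hh fun u => by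
    rw [he, he, toHalfPlane_add_period, exp_add_period]
  refine ⟨N, ?_, hN⟩
  obtain ⟨ε, hε, hεΔ⟩ := Metric.nhds_basis_closedBall.mem_iff.1 (mem_interior_iff_mem_nhds.1 h0)
  have hball : ∀ u, Complex.exp (toHalfPlane (Real.log ε) u) ∈ Δ := fun u => hεΔ <| by
    simpa using norm_exp_le_of_re_le hε (toHalfPlane_re_le _ u)
  obtain ⟨k, hk, hke⟩ := exists_continuous_log
    (Φ := fun u => g (Complex.exp (toHalfPlane (Real.log ε) u)))
    (hF.contDiffOn_inv.continuousOn.comp_continuous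
      (Complex.continuous_exp.comp (continuous_toHalfPlane _)) hball)
    (fun u => hF.inv_ne_zero (hball u) (Complex.exp_ne_zero _))
  obtain ⟨M, hM⟩ := exists_int_log_add_period hk fun u => by
    rw [hke, hke, toHalfPlane_add_period, exp_add_period]
  -- far to the left, `h` takes values in the half-plane on which `k` lifts the inverse chart
  obtain ⟨a, ha0, ha⟩ : ∃ a ≤ (0 : ℝ), ∀ u : ℂ, u.re ≤ a → (h u).re ≤ Real.log ε := by
    have hc := (hF.contDiffOn.continuousOn 0 (by simp)).eventually
      (Metric.closedBall_mem_nhds (F 0) hε)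
    obtain ⟨δ, hδ, hδF⟩ := Metric.mem_nhdsWithin_iff.1 hc
    refine ⟨min 0 (Real.log (δ / 2)), min_le_left _ _, fun u hu => ?_⟩
    have hu0 : u.re ≤ 0 := hu.trans (min_le_left _ _)
    have h1 := norm_exp_le_of_re_le (half_pos hδ) (hu.trans (min_le_right _ _))
    have h2 : F (Complex.exp u) ∈ Metric.closedBall (F 0) ε :=
      hδF ⟨by simpa using h1.trans_lt (half_lt_self hδ), exp_mem_closedBall hu0⟩
    rw [hF.map_zero, mem_closedBall_zero_iff] at h2
    rw [Real.le_log_iff_exp_le hε, ← Complex.norm_exp, he, toHalfPlane_of_le hu0]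
    exact h2
  have hka : ∀ u : ℂ, u.re ≤ a → Complex.exp (k (h u)) = Complex.exp u := fun u hu => by
    rw [hke, toHalfPlane_of_le (ha u hu), he, toHalfPlane_of_le (hu.trans ha0),
      hF.leftInv _ (exp_mem_closedBall (hu.trans ha0))]
  obtain ⟨c, hc⟩ := Complex.exp_eq_exp_iff_exists_int.1 (hka a (by simp))
  have hconv : Convex ℝ {u : ℂ | u.re ≤ a} := convex_halfSpace_re_le a
  have hkh : EqOn (fun u => k (h u)) (fun u => u + c * (2 * Real.pi * Complex.I))
      {u : ℂ | u.re ≤ a} := by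
    refine eqOn_of_exp_eqOn hconv.isPreconnected (by fun_prop) (by fun_prop) (fun u hu => ?_)
      (a := (a : ℂ)) (by simp) hc
    rw [hka u hu, Complex.exp_add, Complex.exp_int_mul_two_pi_mul_I, mul_one]
  have h3 := hkh (x := (a : ℂ) + (1 : ℤ) * (2 * Real.pi * Complex.I)) (by simp)
  simp only [hN] at h3
  have h4 := hM (h a) (1 * N)
  have h5 : h a + (1 * N : ℤ) * (2 * Real.pi * Complex.I)
      = h a + (1 : ℤ) * N * (2 * Real.pi * Complex.I) := by push_cast; ring
  rw [h5, h3, hc] at h4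
  have h6 : (N * M - 1 : ℂ) * (2 * Real.pi * Complex.I) = 0 := by
    push_cast at h4
    linear_combination -h4
  have h7 : (N * M : ℤ) = 1 := by
    rcases mul_eq_zero.1 h6 with h6 | h6
    · exact_mod_cast sub_eq_zero.1 h6
    · exact absurd h6 Complex.two_pi_I_ne_zero
  rcases Int.eq_one_or_neg_one_of_mul_eq_one h7 with h | h <;> simp [h]

end IsCenteredChart

/-- The universal cover of the punctured disc is diffeomorphic to the closed left half-plane. -/
theorem IsDiscAroundZero.exists_cover_diffeo {Δ : Set ℂ} (hΔ : IsDiscAroundZero Δ) :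
    ∃ h k : ℂ → ℂ, ContDiffOn ℝ ∞ h {u | u.re ≤ 0} ∧ ContDiffOn ℝ ∞ k (cover Δ) ∧
      MapsTo h {u | u.re ≤ 0} (cover Δ) ∧ MapsTo k (cover Δ) {u | u.re ≤ 0} ∧
      (∀ u : ℂ, u.re ≤ 0 → k (h u) = u) ∧ ∀ q ∈ cover Δ, h (k q) = q := by
  obtain ⟨F, g, hF⟩ := hΔ.exists_isCenteredChart
  have hmem : ∀ u, Complex.exp (toHalfPlane 0 u) ∈ Metric.closedBall (0 : ℂ) 1 := fun u =>
    exp_mem_closedBall (toHalfPlane_re_le 0 u)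
  obtain ⟨h, hh, he⟩ := exists_continuous_log
    (Φ := fun u => F (Complex.exp (toHalfPlane 0 u)))
    (hF.contDiffOn.continuousOn.comp_continuous
      (Complex.continuous_exp.comp (continuous_toHalfPlane _)) hmem)
    (fun u => hF.ne_zero (hmem u) (Complex.exp_ne_zero _))
  obtain ⟨N, hNN, hN⟩ := hF.exists_log_period hΔ.2 hh he
  have he' : ∀ u : ℂ, u.re ≤ 0 → Complex.exp (h u) = F (Complex.exp u) := fun u hu => by
    rw [he, toHalfPlane_of_le hu]
  have hinj : ∀ u v : ℂ, u.re ≤ 0 → v.re ≤ 0 → h u = h v → u = v := by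
    intro u v hu hv huv
    have h1 : Complex.exp u = Complex.exp v := by
      rw [← hF.leftInv _ (exp_mem_closedBall hu), ← hF.leftInv _ (exp_mem_closedBall hv),
        ← he' u hu, ← he' v hv, huv]
    obtain ⟨j, hj⟩ := Complex.exp_eq_exp_iff_exists_int.1 h1
    have h2 := hN v j
    rw [← hj, huv] at h2
    have h3 : (j * N : ℂ) * (2 * Real.pi * Complex.I) = 0 := by linear_combination -h2
    have h4 : (j * N : ℤ) = 0 := by
      rcases mul_eq_zero.1 h3 with h3 | h3
      · exact_mod_cast h3
      · exact absurd h3 Complex.two_pi_I_ne_zero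
    have h5 : j = 0 := by
      rcases mul_eq_zero.1 h4 with h | h
      · exact h
      · rw [h] at hNN; simp at hNN
    rw [hj, h5]; simp
  have hsurj : ∀ q, ∃ u : ℂ, q ∈ cover Δ → u.re ≤ 0 ∧ h u = q := by
    intro q
    by_cases hq : q ∈ cover Δ
    · have h0 := hF.inv_ne_zero hq (Complex.exp_ne_zero _)
      set v := Complex.log (g (Complex.exp q)) with hv
      have hve : Complex.exp v = g (Complex.exp q) := Complex.exp_log h0
      have hv0 : v.re ≤ 0 := by
        rw [hv, Complex.log_re]
        exact Real.log_nonpos (norm_nonneg _) (by simpa using hF.mapsTo_inv hq)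
      have h1 : Complex.exp (h v) = Complex.exp q := by
        rw [he' v hv0, hve, hF.rightInv _ hq]
      obtain ⟨j, hj⟩ := Complex.exp_eq_exp_iff_exists_int.1 h1
      refine ⟨v + (-(j * N) : ℤ) * (2 * Real.pi * Complex.I), fun _ => ⟨by simpa using hv0, ?_⟩⟩
      rw [hN, hj]
      have : ((N : ℂ) * N) = 1 := by exact_mod_cast hNN
      push_cast
      linear_combination -(j : ℂ) * (2 * Real.pi * Complex.I) * this
    · exact ⟨0, fun h => absurd h hq⟩
  choose k hk using hsurj
  have hmaps : MapsTo h {u | u.re ≤ 0} (cover Δ) := fun u hu => by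
    change Complex.exp (h u) ∈ Δ
    rw [he' u hu]
    exact hF.mapsTo (exp_mem_closedBall hu)
  have hexp : ContDiff ℝ ∞ Complex.exp := Complex.contDiff_exp
  have hkexp : ∀ q ∈ cover Δ, Complex.exp (k q) = g (Complex.exp q) := fun q hq => by
    rw [← hF.leftInv _ (exp_mem_closedBall (hk q hq).1), ← he' _ (hk q hq).1, (hk q hq).2]
  have hgexp : ContDiffOn ℝ ∞ (fun q => g (Complex.exp q)) (cover Δ) :=
    hF.contDiffOn_inv.comp hexp.contDiffOn fun q hq => hq
  refine ⟨h, k, fun u hu => contDiffWithinAt_of_exp hh.continuousWithinAt ?_,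
    fun q hq => contDiffWithinAt_of_exp ?_ ((hgexp q hq).congr hkexp (hkexp q hq)), hmaps,
    fun q hq => (hk q hq).1, fun u hu => hinj _ _ (hk _ (hmaps hu)).1 hu (hk _ (hmaps hu)).2,
    fun q hq => (hk q hq).2⟩
  · exact ((hF.contDiffOn.comp hexp.contDiffOn fun u hu => exp_mem_closedBall hu) u hu).congr he'
      (he' u hu)
  -- `k` is continuous, since near `q` it is the branch of the logarithm which is close to `k q`
  have hg0 : g (Complex.exp q) ≠ 0 := hF.inv_ne_zero hq (Complex.exp_ne_zero _)
  let l : ℂ → ℂ := fun p => k q + Complex.log (g (Complex.exp p) / g (Complex.exp q))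
  have hl : ContinuousWithinAt l (cover Δ) q := by
    refine continuousWithinAt_const.add (ContinuousAt.comp_continuousWithinAt (g := Complex.log) ?_
      ((hgexp.continuousOn q hq).div_const _))
    rw [div_self hg0]
    exact continuousAt_clog (by simp)
  have hlq : l q = k q := by simp [l, div_self hg0]
  have hle : ∀ p ∈ cover Δ, Complex.exp (l p) = g (Complex.exp p) := fun p hp => by
    rw [Complex.exp_add, Complex.exp_log (div_ne_zero (hF.inv_ne_zero hp (Complex.exp_ne_zero _))
      hg0), hkexp q hq, mul_div_cancel₀ _ hg0]
  have hl0 : ∀ p ∈ cover Δ, (l p).re ≤ 0 := fun p hp => by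
    have := hF.mapsTo_inv hp
    rw [← hle p hp, mem_closedBall_zero_iff, Complex.norm_exp] at this
    exact Real.exp_le_one_iff.1 this
  have hhl : ∀ᶠ p in 𝓝[cover Δ] q, h (l p) = p := by
    have h1 : ContinuousWithinAt (fun p => h (l p) - p) (cover Δ) q :=
      (hh.continuousAt.comp_continuousWithinAt hl).sub continuousWithinAt_id
    filter_upwards [eventually_eq_add_log h1, self_mem_nhdsWithin] with p hp hpm
    have h2 : ∀ p ∈ cover Δ, Complex.exp (h (l p) - p) = 1 := fun p hp => by
      rw [Complex.exp_sub, he' _ (hl0 p hp), hle p hp, hF.rightInv _ hp,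
        div_self (Complex.exp_ne_zero _)]
    rw [h2 p hpm, h2 q hq, hlq, (hk q hq).2] at hp
    simpa [sub_eq_zero] using hp
  refine hl.congr_of_eventuallyEq ?_ hlq.symm
  filter_upwards [hhl, self_mem_nhdsWithin] with p hp hpm
  exact hinj _ _ (hk p hpm).1 (hl0 p hpm) ((hk p hpm).2.trans hp.symm)

end HalfPlane

/-! ### Minkowski adjoints -/

section Adjoint

variable {n : ℕ}

theorem ip_comm (x y : Mink n) : ip x y = ip y x := by
  simp only [ip, mul_comm]

theorem ip_add_right (x y z : Mink n) : ip x (y + z) = ip x y + ip x z := map_add (dual x) y z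

theorem ip_smul_right (c : ℝ) (x y : Mink n) : ip x (c • y) = c * ip x y := map_smul (dual x) c y

theorem ip_add_left (x y z : Mink n) : ip (x + y) z = ip x z + ip y z := by
  rw [ip_comm, ip_add_right, ip_comm z x, ip_comm z y]

theorem ip_smul_left (c : ℝ) (x y : Mink n) : ip (c • x) y = c * ip x y := by
  rw [ip_comm, ip_smul_right, ip_comm]

theorem ip_neg_right (x y : Mink n) : ip x (-y) = -ip x y := map_neg (dual x) y

theorem ip_sub_right (x y z : Mink n) : ip x (y - z) = ip x y - ip x z := map_sub (dual x) y z

theorem ip_sum_right {ι : Type*} (s : Finset ι) (x : Mink n) (f : ι → Mink n) :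
    ip x (∑ i ∈ s, f i) = ∑ i ∈ s, ip x (f i) := map_sum (dual x) f s

theorem continuous_ip : Continuous fun p : Mink n × Mink n => ip p.1 p.2 := by
  unfold ip
  fun_prop

theorem outer_apply (a b x : Mink n) : outer a b x = ip b x • a := rfl

theorem wedge_apply (v w x : Mink n) : wedge v w x = ip v x • w - ip w x • v := rfl

/-- The standard basis vector. -/
noncomputable def stdVec (i : Fin (n + 2)) : Mink n := EuclideanSpace.single i 1

/-- The square of a standard basis vector: `-1` for the timelike one, `1` for the others. -/
def signature (i : Fin (n + 2)) : ℝ := if i = 0 then -1 else 1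

theorem signature_mul_self (i : Fin (n + 2)) : signature i * signature i = 1 := by
  unfold signature; split_ifs <;> norm_num

theorem ip_stdVec (x : Mink n) (i : Fin (n + 2)) : ip x (stdVec i) = signature i * x i := by
  unfold ip stdVec signature
  refine Fin.cases ?_ (fun j => ?_) i
  · simp
  · simp [Fin.succ_ne_zero, Fin.succ_inj, PiLp.single_apply, (Fin.succ_ne_zero j).symm]

theorem sum_smul_stdVec (x : Mink n) : ∑ i, x i • (stdVec i : Mink n) = x := by
  have := (EuclideanSpace.basisFun (Fin (n + 2)) ℝ).sum_repr x
  simpa [stdVec] using this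

theorem eq_of_forall_ip_eq {x y : Mink n} (h : ∀ z, ip z x = ip z y) : x = y := by
  ext i
  have h1 := h (stdVec i)
  rw [ip_comm, ip_stdVec, ip_comm, ip_stdVec] at h1
  have h2 : signature i ≠ 0 := fun h0 => by simpa [h0] using signature_mul_self i
  exact mul_left_cancel₀ h2 h1

/-- The adjoint with respect to the Minkowski inner product, as a continuous linear map on the
space of endomorphisms. It is written out in the standard basis, which makes its linearity over
`ℝ` evident. -/
noncomputable def adj : EndMink n →L[ℝ] EndMink n :=
  LinearMap.toContinuousLinearMap
    { toFun := fun A => ∑ i, signature i • outer (stdVec i) (A (stdVec i))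
      map_add' := fun A B => by
        ext1 x
        simp [outer_apply, ip_add_left, Finset.sum_add_distrib, add_smul]
      map_smul' := fun c A => by
        ext1 x
        simp [outer_apply, ip_smul_left, Finset.smul_sum, mul_smul, smul_comm c] }

theorem adj_apply (A : EndMink n) (x : Mink n) :
    adj A x = ∑ i, signature i • ip (A (stdVec i)) x • (stdVec i : Mink n) := by
  simp [adj, outer_apply]

theorem ip_adj_right (A : EndMink n) (x y : Mink n) : ip x (adj A y) = ip (A x) y := by
  conv_rhs => rw [← sum_smul_stdVec x, map_sum, ip_comm, ip_sum_right]
  rw [adj_apply, ip_sum_right]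
  refine Finset.sum_congr rfl fun i _ => ?_
  rw [ip_smul_right, ip_smul_right, ip_stdVec, map_smul, ip_smul_right, ip_comm y]
  linear_combination (ip (A (stdVec i)) y * x i) * signature_mul_self i

theorem eq_adj {A B : EndMink n} (h : ∀ x y, ip x (B y) = ip (A x) y) : B = adj A := by
  ext1 y
  exact eq_of_forall_ip_eq fun z => by rw [h, ip_adj_right]

theorem adj_adj (A : EndMink n) : adj (adj A) = A :=
  (eq_adj fun x y => by rw [ip_comm, ← ip_adj_right, ip_comm]).symm

theorem adj_mul (A B : EndMink n) : adj (A * B) = adj B * adj A :=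
  (eq_adj fun x y => by
    rw [mul_apply_eq_comp, ip_adj_right, ip_adj_right,
      mul_apply_eq_comp]).symm

theorem adj_one : adj (1 : EndMink n) = 1 := (eq_adj fun _ _ => rfl).symm

theorem adj_outer (a b : Mink n) : adj (outer a b) = outer b a :=
  (eq_adj fun x y => by
    rw [outer_apply, outer_apply, ip_smul_right, ip_smul_left, ip_comm x b]; ring).symm

theorem IsSkew.adj_eq {A : EndMink n} (hA : IsSkew A) : adj A = -A :=
  (eq_adj fun x y => by rw [hA, neg_apply, ip_neg_right]).symm

theorem endMink_mul_eq_one_comm {A B : EndMink n} (h : A * B = 1) : B * A = 1 := by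
  have h1 : (A : Mink n →ₗ[ℝ] Mink n) * (B : Mink n →ₗ[ℝ] Mink n) = 1 := by
    ext1 x; exact congrArg (fun T : EndMink n => T x) h
  have h2 := mul_eq_one_comm.1 h1
  ext1 x
  exact congrArg (fun T : Mink n →ₗ[ℝ] Mink n => T x) h2

end Adjoint

/-! ### Primitives on the universal cover -/

section Primitives

variable {n : ℕ} {Δ : Set ℂ}

theorem convex_leftHalfPlane : Convex ℝ {u : ℂ | u.re ≤ 0} := convex_halfSpace_re_le 0

theorem interior_leftHalfPlane_nonempty : (interior {u : ℂ | u.re ≤ 0}).Nonempty :=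
  ⟨-1, by rw [Complex.interior_setOfPred_re_le]; simp⟩

theorem uniqueDiffOn_leftHalfPlane : UniqueDiffOn ℝ {u : ℂ | u.re ≤ 0} :=
  uniqueDiffOn_convex convex_leftHalfPlane interior_leftHalfPlane_nonempty

theorem hasFDerivAt_exp_real (z : ℂ) :
    HasFDerivAt Complex.exp (Complex.exp z • ContinuousLinearMap.id ℝ ℂ) z := by
  refine ((Complex.hasDerivAt_exp z).hasFDerivAt.restrictScalars ℝ).congr_fderiv ?_
  ext x
  simp [mul_comm]

/-- The cover is connected, being the image of a half-plane; so functions with vanishing derivative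
are constant, also at the boundary. -/
theorem constant_on_cover (hΔ : IsDiscAroundZero Δ) {V : Type*} [NormedAddCommGroup V]
    [NormedSpace ℝ V] {f : ℂ → V}
    (hf : ∀ q ∈ cover Δ, HasFDerivWithinAt f (0 : ℂ →L[ℝ] V) (cover Δ) q) {p q : ℂ}
    (hp : p ∈ cover Δ) (hq : q ∈ cover Δ) : f p = f q := by
  obtain ⟨h, k, hh, hk, hhm, hkm, hkh, hhk⟩ := hΔ.exists_cover_diffeo
  have hd : ∀ u ∈ {u : ℂ | u.re ≤ 0},
      HasFDerivWithinAt (f ∘ h) (0 : ℂ →L[ℝ] V) {u : ℂ | u.re ≤ 0} u := fun u hu => by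
    have := (hf _ (hhm hu)).comp u ((hh.differentiableOn (by simp) u hu).hasFDerivWithinAt) hhm
    simpa using this
  have := convex_leftHalfPlane.is_const_of_fderivWithin_eq_zero
    (fun u hu => (hd u hu).differentiableWithinAt)
    (fun u hu => (hd u hu).fderivWithin (uniqueDiffOn_leftHalfPlane u hu)) (hkm hp) (hkm hq)
  simpa [hhk p hp, hhk q hq] using this

theorem mapsTo_exp_cover : MapsTo Complex.exp (cover Δ) (Δ \ {0}) :=
  fun u hu => ⟨hu, Complex.exp_ne_zero u⟩

theorem contDiffOn_pullback {ψ : Form n} (hψ : ContDiffOn ℝ ∞ ψ (Δ \ {0})) :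
    ContDiffOn ℝ ∞ (pullback ψ) (cover Δ) := by
  have hexp : ContDiff ℝ ∞ Complex.exp := Complex.contDiff_exp
  exact (hψ.comp hexp.contDiffOn mapsTo_exp_cover).clm_comp
    (hexp.smul contDiff_const).contDiffOn

/-- Transported to the half-plane by a diffeomorphism, the form is flat on a convex set. -/
theorem exists_isPrimitiveWithin_pullback (hΔ : IsDiscAroundZero Δ) {ψ : Form n}
    (hψ : ContDiffOn ℝ ∞ ψ (Δ \ {0})) (hflat : IsFlatOn ψ (Δ \ {0})) {p : ℂ} (hp : p ∈ cover Δ) :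
    ∃ G : ℂ → EndMink n, G p = 1 ∧ IsPrimitiveWithin G (pullback ψ) (cover Δ) := by
  obtain ⟨h, k, hh, hk, hhm, hkm, hkh, hhk⟩ := hΔ.exists_cover_diffeo
  set D : Set ℂ := {u : ℂ | u.re ≤ 0} with hD
  have hDu : UniqueDiffOn ℝ D := uniqueDiffOn_leftHalfPlane
  have hexp : ContDiff ℝ ∞ Complex.exp := Complex.contDiff_exp
  let Φ : ℂ → ℂ := fun u => Complex.exp (h u)
  have hΦ : ContDiffOn ℝ ∞ Φ D := hexp.comp_contDiffOn hh
  have hΦm : MapsTo Φ D (Δ \ {0}) := fun u hu => mapsTo_exp_cover (hhm hu)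
  have hDi : D ⊆ closure (interior D) := by
    rw [convex_leftHalfPlane.closure_interior_eq_closure_of_nonempty_interior
      interior_leftHalfPlane_nonempty]
    exact subset_closure
  have hfl := FlatWithin.pullback hDu hDi (hΦ.of_le ENat.LEInfty.out) hΦm
    (hψ.differentiableOn (by simp)) (show FlatWithin ψ (Δ \ {0}) from hflat)
  have hsm : ContDiffOn ℝ 2 (fun u => ψ (Φ u) ∘L fderivWithin ℝ Φ D u) D :=
    ((hψ.comp hΦ hΦm).clm_comp (hΦ.fderivWithin hDu (by simp))).of_le ENat.LEInfty.out
  obtain ⟨G, hG1, hG⟩ := exists_isPrimitiveWithin_of_flatWithin convex_leftHalfPlane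
    (isClosed_le Complex.continuous_re continuous_const) hDu hsm hfl (hkm hp)
  refine ⟨G ∘ k, hG1, fun q hq => ?_⟩
  have hk' := (hk.differentiableOn (by simp) q hq).hasFDerivWithinAt
  refine ((hG _ (hkm hq)).comp q hk' hkm).congr_fderiv ?_
  have hh' := (hh.differentiableOn (by simp) _ (hkm hq)).hasFDerivWithinAt
  -- the derivatives of the two inverse diffeomorphisms are inverse to each other
  have hkh' : fderivWithin ℝ k (cover Δ) q ∘L fderivWithin ℝ h D (k q)
      = ContinuousLinearMap.id ℝ ℂ := by
    have hk2 := (hk.differentiableOn (by simp) _ (hhm (hkm hq))).hasFDerivWithinAt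
    have h1 := hk2.comp (k q) hh' hhm
    rw [hhk q hq] at h1
    have h2 : HasFDerivWithinAt (k ∘ h) (ContinuousLinearMap.id ℝ ℂ) D (k q) :=
      (hasFDerivWithinAt_id _ _).congr (fun u hu => hkh u hu) (hkh _ (hkm hq))
    exact (hDu _ (hkm hq)).eq h1 h2
  have hhk' : fderivWithin ℝ h D (k q) ∘L fderivWithin ℝ k (cover Δ) q
      = ContinuousLinearMap.id ℝ ℂ := by
    have h1 : (fderivWithin ℝ k (cover Δ) q : ℂ →ₗ[ℝ] ℂ) * (fderivWithin ℝ h D (k q) : ℂ →ₗ[ℝ] ℂ)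
        = 1 := by
      ext1 x; exact congrArg (fun T : ℂ →L[ℝ] ℂ => T x) hkh'
    have h2 := mul_eq_one_comm.1 h1
    exact ContinuousLinearMap.ext fun x => congrArg (fun T : ℂ →ₗ[ℝ] ℂ => T x) h2
  have hΦ' : fderivWithin ℝ Φ D (k q)
      = (Complex.exp q • ContinuousLinearMap.id ℝ ℂ) ∘L fderivWithin ℝ h D (k q) := by
    have := (hasFDerivAt_exp_real (h (k q))).comp_hasFDerivWithinAt (k q) hh'
    rw [hhk q hq] at this
    exact this.fderivWithin (hDu _ (hkm hq))
  simp only [hΦ', pullback, Φ, hhk q hq, ContinuousLinearMap.comp_assoc, hhk', Function.comp_apply,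
    ContinuousLinearMap.comp_id]

theorem isPrimitive_iff {ψ : Form n} {p : ℂ} {G : ℂ → EndMink n} :
    IsPrimitive Δ ψ p G ↔ G p = 1 ∧ IsPrimitiveWithin G (pullback ψ) (cover Δ) := Iff.rfl

theorem IsPrimitiveWithin.const_mul {G : ℂ → EndMink n} {Ω : Form n} {S : Set ℂ}
    (hG : IsPrimitiveWithin G Ω S) (A : EndMink n) : IsPrimitiveWithin (fun u => A * G u) Ω S := by
  intro u hu
  refine ((hG u hu).const_mul A).congr_fderiv ?_
  ext1 a
  simp [mul_assoc]

/-- For skew forms the adjoint of a primitive is its inverse up to a constant factor, and so any two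
primitives differ by a constant left factor. -/
theorem constant_mul_adj (hΔ : IsDiscAroundZero Δ) {η : Form n}
    (hη : ∀ u ∈ cover Δ, ∀ a, IsSkew (η u a)) {G H : ℂ → EndMink n}
    (hG : IsPrimitiveWithin G η (cover Δ)) (hH : IsPrimitiveWithin H η (cover Δ)) {p q : ℂ}
    (hp : p ∈ cover Δ) (hq : q ∈ cover Δ) : G p * adj (H p) = G q * adj (H q) := by
  refine constant_on_cover hΔ (f := fun u => G u * adj (H u)) (fun u hu => ?_) hp hq
  refine ((hG u hu).mul' (adj.hasFDerivAt.comp_hasFDerivWithinAt u (hH u hu))).congr_fderiv ?_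
  ext1 a
  simp [adj_mul, (hη u hu a).adj_eq, mul_assoc]
  rw [← mul_add, ← add_mul, neg_add_cancel, zero_mul, mul_zero]

/-- A primitive with values in the Lorentz group, from which all normalized primitives are
obtained. -/
theorem exists_lorentz_primitive (hΔ : IsDiscAroundZero Δ) {ψ ξ : Form n}
    (hψ : IsPoleForm Δ ψ ξ) : ∃ G : ℂ → EndMink n,
      IsPrimitiveWithin G (pullback ψ) (cover Δ) ∧ ContDiffOn ℝ ∞ G (cover Δ) ∧
      (∀ u ∈ cover Δ, G u * adj (G u) = 1) ∧ (∀ u ∈ cover Δ, adj (G u) * G u = 1) ∧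
      ∀ p q : cover Δ, primitive Δ ψ p q = adj (G p) * G q := by
  have hskew : ∀ u ∈ cover Δ, ∀ a, IsSkew (pullback ψ u a) := fun u hu a =>
    hψ.skew _ (mapsTo_exp_cover hu) _
  by_cases hne : (cover Δ).Nonempty
  swap
  · rw [not_nonempty_iff_eq_empty] at hne
    refine ⟨0, ?_, ?_, ?_, ?_, fun p => absurd p.2 ?_⟩ <;> simp [hne, IsPrimitiveWithin]
  obtain ⟨p₀, hp₀⟩ := hne
  obtain ⟨G, hG1, hG⟩ := exists_isPrimitiveWithin_pullback hΔ hψ.smooth hψ.flat hp₀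
  have h1 : ∀ u ∈ cover Δ, G u * adj (G u) = 1 := fun u hu => by
    rw [constant_mul_adj hΔ hskew hG hG hu hp₀, hG1, adj_one, mul_one]
  have h2 : ∀ u ∈ cover Δ, adj (G u) * G u = 1 := fun u hu => endMink_mul_eq_one_comm (h1 u hu)
  refine ⟨G, hG, hG.contDiffOn (contDiffOn_pullback hψ.smooth), h1, h2, fun p q => ?_⟩
  have hex : ∃ H : ℂ → EndMink n, IsPrimitive Δ ψ p H :=
    ⟨fun u => adj (G p) * G u, isPrimitive_iff.2 ⟨h2 _ p.2, hG.const_mul _⟩⟩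
  obtain ⟨hH1, hH⟩ := isPrimitive_iff.1 hex.choose_spec
  rw [primitive, dif_pos hex]
  have h3 := constant_mul_adj hΔ hskew hH hG q.2 p.2
  rw [hH1, one_mul] at h3
  rw [← h3, mul_assoc, h2 _ q.2, mul_one]

end Primitives

/-! ### Asymptotics of a linear system near a pole -/

section Radial

variable {𝔸 : Type*} [NormedRing 𝔸] [NormedAlgebra ℝ 𝔸]

theorem norm_sub_le_of_norm_deriv_le {V : Type*} [NormedAddCommGroup V] [NormedSpace ℝ V]
    {f f' : ℝ → V} {b b' : ℝ → ℝ} {s t : ℝ} (hst : s ≤ t)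
    (hf : ∀ x ∈ Icc s t, HasDerivAt f (f' x) x) (hb : ∀ x, HasDerivAt b (b' x) x)
    (h : ∀ x ∈ Icc s t, ‖f' x‖ ≤ b' x) : ‖f t - f s‖ ≤ b t - b s := by
  refine image_norm_le_of_norm_deriv_right_le_deriv_boundary (f := fun x => f x - f s) (f' := f')
    (B := fun x => b x - b s) (B' := b') (a := s) (b := t) ?_ ?_ (by simp) ?_ ?_ ⟨hst, le_rfl⟩
  · exact fun x hx => ((hf x hx).sub_const _).continuousAt.continuousWithinAt
  · exact fun x hx => ((hf x (Ico_subset_Icc_self hx)).sub_const _).hasDerivWithinAt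
  · exact fun x => (hb x).sub_const _
  · exact fun x hx => h x (Ico_subset_Icc_self hx)

/-- The projections `P₊`, `P₀`, `P₋` decompose the identity into spectral projections of `A` for
the eigenvalues `ζ`, `0`, `-ζ`. -/
structure IsSpectralSplitting (ζ : ℝ) (A Pp P₀ Pm : 𝔸) : Prop where
  sum_eq : Pp + P₀ + Pm = 1
  mul_pos : A * Pp = ζ • Pp
  mul_zero : A * P₀ = 0
  mul_neg : A * Pm = -(ζ • Pm)

/-- `X' = X (ζ - A + R)` on `(-∞, t₀]`, with a perturbation `R` bounded by `C e^s`. -/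
structure IsRadialSolution (ζ : ℝ) (A : 𝔸) (C t₀ : ℝ) (X R : ℝ → 𝔸) : Prop where
  hasDerivAt : ∀ s ≤ t₀, HasDerivAt X (X s * (ζ • 1 - A + R s)) s
  norm_le : ∀ s ≤ t₀, ‖R s‖ ≤ C * Real.exp s

variable {ζ C t₀ : ℝ} {A Pp P₀ Pm : 𝔸} {X R : ℝ → 𝔸}

theorem IsRadialSolution.const_mul (hX : IsRadialSolution ζ A C t₀ X R) (L : 𝔸) :
    IsRadialSolution ζ A C t₀ (fun s => L * X s) R :=
  ⟨fun s hs => by simpa [mul_assoc] using (hX.hasDerivAt s hs).const_mul L, hX.norm_le⟩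

theorem IsRadialSolution.nonneg (hX : IsRadialSolution ζ A C t₀ X R) : 0 ≤ C := by
  have := (norm_nonneg _).trans (hX.norm_le t₀ le_rfl)
  exact nonneg_of_mul_nonneg_left this (Real.exp_pos _)

/-- Variation of constants: the unperturbed flow `E(s) = P₊ + e^{ζs} P₀ + e^{2ζs} P₋` is bounded for
`s ≤ 0`, and the perturbation is small near `-∞`. -/
theorem IsRadialSolution.norm_le_mul (hX : IsRadialSolution ζ A C t₀ X R) (hζ : 0 < ζ)
    (hA : IsSpectralSplitting ζ A Pp P₀ Pm)
    (hsmall : (‖Pp‖ + ‖P₀‖ + ‖Pm‖) * C * Real.exp t₀ ≤ 1 / 2) {t t₁ : ℝ} (ht : t ≤ t₁)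
    (ht₁ : t₁ ≤ t₀) : ‖X t‖ ≤ 2 * (‖Pp‖ + ‖P₀‖ + ‖Pm‖) * ‖X t₁‖ := by
  set c := ‖Pp‖ + ‖P₀‖ + ‖Pm‖ with hc
  have hc0 : 0 ≤ c := by positivity
  have hC0 := hX.nonneg
  let E : ℝ → 𝔸 := fun s => Pp + Real.exp (ζ * s) • P₀ + Real.exp (2 * ζ * s) • Pm
  have hE0 : E 0 = 1 := by simp [E, hA.sum_eq]
  have hEc : ∀ s ≤ 0, ‖E s‖ ≤ c := by
    intro s hs
    refine norm_add₃_le.trans ?_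
    rw [norm_smul, norm_smul, Real.norm_eq_abs, Real.norm_eq_abs, Real.abs_exp, Real.abs_exp]
    have h1 : Real.exp (ζ * s) ≤ 1 := Real.exp_le_one_iff.2 (by nlinarith)
    have h2 : Real.exp (2 * ζ * s) ≤ 1 := Real.exp_le_one_iff.2 (by nlinarith)
    have h3 := mul_le_of_le_one_left (norm_nonneg P₀) h1
    have h4 := mul_le_of_le_one_left (norm_nonneg Pm) h2
    linarith
  have hE' : ∀ s, HasDerivAt E ((ζ • 1 - A) * E s) s := by
    intro s
    have h1 : HasDerivAt (fun s => Real.exp (ζ * s)) (Real.exp (ζ * s) * ζ) s := by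
      simpa using ((hasDerivAt_id s).const_mul ζ).exp
    have h2 : HasDerivAt (fun s => Real.exp (2 * ζ * s)) (Real.exp (2 * ζ * s) * (2 * ζ)) s := by
      simpa using ((hasDerivAt_id s).const_mul (2 * ζ)).exp
    refine (((h1.smul_const P₀).const_add Pp).add (h2.smul_const Pm)).congr_deriv ?_
    simp only [E, sub_mul, mul_add, smul_mul_assoc, one_mul, mul_smul_comm, hA.mul_pos, hA.mul_zero,
      hA.mul_neg]
    module
  obtain ⟨m, hm, hmax⟩ := isCompact_Icc.exists_isMaxOn (nonempty_Icc.2 ht)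
    (f := fun s => ‖X s‖) (fun s hs =>
      (hX.hasDerivAt s (hs.2.trans ht₁)).continuousAt.norm.continuousWithinAt)
  have hXm : ∀ s ∈ Icc t t₁, ‖X s‖ ≤ ‖X m‖ := fun s hs => hmax hs
  have hd : ∀ s ∈ Icc m t₁, HasDerivAt (fun s => X s * E (m - s)) (X s * R s * E (m - s)) s := by
    intro s hs
    have h1 : HasDerivAt (fun s => E (m - s)) (-((ζ • 1 - A) * E (m - s))) s := by
      have := (hE' (m - s)).scomp s ((hasDerivAt_id s).const_sub m)
      rwa [neg_one_smul] at this
    refine ((hX.hasDerivAt s (hs.2.trans ht₁)).mul h1).congr_deriv ?_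
    noncomm_ring
  have hb := norm_sub_le_of_norm_deriv_le (b := fun s => ‖X m‖ * C * c * Real.exp s) hm.2 hd
    (fun s => (Real.hasDerivAt_exp s).const_mul _) (fun s hs => by
      calc ‖X s * R s * E (m - s)‖ ≤ ‖X s‖ * ‖R s‖ * ‖E (m - s)‖ :=
            (norm_mul_le _ _).trans (by gcongr; exact norm_mul_le _ _)
        _ ≤ ‖X m‖ * (C * Real.exp s) * c := by
            gcongr
            · exact hXm s ⟨hm.1.trans hs.1, hs.2⟩
            · exact hX.norm_le s (hs.2.trans ht₁)
            · exact hEc _ (by linarith [hs.1])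
        _ = _ := by ring)
  simp only [sub_self, hE0, mul_one] at hb
  have h1 : ‖X t₁ * E (m - t₁)‖ ≤ ‖X t₁‖ * c :=
    (norm_mul_le _ _).trans (by gcongr; exact hEc _ (by linarith [hm.2]))
  have h2 : ‖X m‖ * C * c * Real.exp t₁ ≤ ‖X m‖ * (1 / 2) := by
    calc _ ≤ ‖X m‖ * C * c * Real.exp t₀ := by gcongr
      _ = ‖X m‖ * (c * C * Real.exp t₀) := by ring
      _ ≤ _ := by gcongr
  have h3 : 0 ≤ ‖X m‖ * C * c * Real.exp m := by positivity
  have h4 : ‖X m‖ ≤ ‖X t₁ * E (m - t₁)‖ + ‖X t₁ * E (m - t₁) - X m‖ := by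
    rw [norm_sub_rev]
    simpa using norm_add_le (X t₁ * E (m - t₁)) (X m - X t₁ * E (m - t₁))
  have h5 := hXm t ⟨le_rfl, ht⟩
  linarith

/-- On the kernel of `ζ - A`, the solution changes only by the integrable perturbation. -/
theorem IsRadialSolution.norm_mul_pos_sub_le (hX : IsRadialSolution ζ A C t₀ X R)
    (hP : A * Pp = ζ • Pp) {t t₁ M : ℝ} (ht : t ≤ t₁) (ht₁ : t₁ ≤ t₀)
    (hM : ∀ s ∈ Icc t t₁, ‖X s‖ ≤ M) :
    ‖X t₁ * Pp - X t * Pp‖ ≤ M * C * ‖Pp‖ * Real.exp t₁ := by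
  have hM0 : 0 ≤ M := (norm_nonneg _).trans (hM t ⟨le_rfl, ht⟩)
  have hC0 := hX.nonneg
  have hd : ∀ s ∈ Icc t t₁, HasDerivAt (fun s => X s * Pp) (X s * R s * Pp) s := by
    intro s hs
    refine ((hX.hasDerivAt s (hs.2.trans ht₁)).mul_const Pp).congr_deriv ?_
    simp only [mul_assoc, add_mul, sub_mul, smul_mul_assoc, one_mul, hP]
    simp
  have hb := norm_sub_le_of_norm_deriv_le (b := fun s => M * C * ‖Pp‖ * Real.exp s) ht hd
    (fun s => (Real.hasDerivAt_exp s).const_mul _) (fun s hs => by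
      calc ‖X s * R s * Pp‖ ≤ ‖X s‖ * ‖R s‖ * ‖Pp‖ :=
            (norm_mul_le _ _).trans (by gcongr; exact norm_mul_le _ _)
        _ ≤ M * (C * Real.exp s) * ‖Pp‖ := by
            gcongr
            · exact hM s hs
            · exact hX.norm_le s (hs.2.trans ht₁)
        _ = _ := by ring)
  have : 0 ≤ M * C * ‖Pp‖ * Real.exp t := by positivity
  linarith

/-- On an eigenspace of `ζ - A` with a positive eigenvalue `l`, the solution decays as `t → -∞`. The
exponent `k < l`, `k ≤ 1` stays clear of the resonance `l = 1`. -/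
theorem IsRadialSolution.norm_mul_le_of_decay (hX : IsRadialSolution ζ A C t₀ X R) {P : 𝔸} {l k : ℝ}
    (hP : A * P = (ζ - l) • P) (hkl : k < l) (hk1 : k ≤ 1) (ht₀ : t₀ ≤ 0) {t M : ℝ}
    (ht : t ≤ t₀) (hM : ∀ s ∈ Icc t t₀, ‖X s‖ ≤ M) :
    ‖X t * P‖ ≤ Real.exp (l * (t - t₀)) * ‖X t₀ * P‖
      + M * C * ‖P‖ / (l - k) * Real.exp (k * t) := by
  have hM0 : 0 ≤ M := (norm_nonneg _).trans (hM t ⟨le_rfl, ht⟩)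
  have hC0 := hX.nonneg
  have hlk : 0 < l - k := sub_pos.2 hkl
  have hd : ∀ s ∈ Icc t t₀, HasDerivAt (fun s => Real.exp (-l * s) • (X s * P))
      (Real.exp (-l * s) • (X s * R s * P)) s := by
    intro s hs
    have h1 : HasDerivAt (fun s => Real.exp (-l * s)) (Real.exp (-l * s) * -l) s := by
      simpa using ((hasDerivAt_id s).const_mul (-l)).exp
    refine (h1.smul ((hX.hasDerivAt s hs.2).mul_const P)).congr_deriv ?_
    simp only [mul_assoc, add_mul, sub_mul, smul_mul_assoc, one_mul, hP, mul_add, mul_sub,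
      mul_smul_comm]
    module
  have hb := norm_sub_le_of_norm_deriv_le
    (b := fun s => -(M * C * ‖P‖ / (l - k)) * Real.exp (-(l - k) * s))
    (b' := fun s => M * C * ‖P‖ * Real.exp (-(l - k) * s)) ht hd
    (fun s => by
      have h1 : HasDerivAt (fun s => Real.exp (-(l - k) * s))
          (Real.exp (-(l - k) * s) * -(l - k)) s := by
        simpa using ((hasDerivAt_id s).const_mul (-(l - k))).exp
      refine (h1.const_mul (-(M * C * ‖P‖ / (l - k)))).congr_deriv ?_
      field_simp) (fun s hs => by
      rw [norm_smul, Real.norm_eq_abs, Real.abs_exp]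
      calc _ ≤ Real.exp (-l * s) * (‖X s‖ * ‖R s‖ * ‖P‖) := by
            gcongr
            exact (norm_mul_le _ _).trans (by gcongr; exact norm_mul_le _ _)
        _ ≤ Real.exp (-l * s) * (M * (C * Real.exp s) * ‖P‖) := by
            gcongr
            · exact hM s hs
            · exact hX.norm_le s hs.2
        _ = M * C * ‖P‖ * Real.exp (-l * s + s) := by rw [Real.exp_add]; ring
        _ ≤ _ := by
            gcongr
            nlinarith [hs.2])
  have h1 : ‖Real.exp (-l * t) • (X t * P)‖ ≤ Real.exp (-l * t₀) * ‖X t₀ * P‖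
      + M * C * ‖P‖ / (l - k) * Real.exp (-(l - k) * t) := by
    have h2 : ‖Real.exp (-l * t) • (X t * P)‖ ≤ ‖Real.exp (-l * t₀) • (X t₀ * P)‖
        + ‖Real.exp (-l * t₀) • (X t₀ * P) - Real.exp (-l * t) • (X t * P)‖ := by
      rw [norm_sub_rev]
      simpa using norm_add_le (Real.exp (-l * t₀) • (X t₀ * P))
        (Real.exp (-l * t) • (X t * P) - Real.exp (-l * t₀) • (X t₀ * P))
    have h3 : 0 ≤ M * C * ‖P‖ / (l - k) * Real.exp (-(l - k) * t₀) := by positivity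
    have h4 : ‖Real.exp (-l * t₀) • (X t₀ * P)‖ = Real.exp (-l * t₀) * ‖X t₀ * P‖ := by
      rw [norm_smul, Real.norm_eq_abs, Real.abs_exp]
    linarith
  rw [norm_smul, Real.norm_eq_abs, Real.abs_exp] at h1
  have h2 := mul_le_mul_of_nonneg_left h1 (Real.exp_pos (l * t)).le
  rw [← mul_assoc, ← Real.exp_add, mul_add, ← mul_assoc, ← Real.exp_add, mul_left_comm,
    ← Real.exp_add] at h2
  have e1 : l * t + -l * t = 0 := by ring
  have e2 : l * t + -l * t₀ = l * (t - t₀) := by ring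
  have e3 : l * t + -(l - k) * t = k * t := by ring
  rwa [e1, e2, e3, Real.exp_zero, one_mul] at h2

end Radial

section HalfPlaneLimit

variable {𝔸 : Type*} [NormedRing 𝔸] [NormedAlgebra ℝ 𝔸]

/-- On the half-plane `Re u ≤ t₀`, `dH = H (ζ dt + η)` with `η = -A dt + B dφ + O(e^t)`, where
`u = t + iφ`. -/
structure IsPoleSolution (ζ : ℝ) (A B : 𝔸) (C t₀ : ℝ) (H : ℂ → 𝔸) (η : ℂ → ℂ →L[ℝ] 𝔸) : Prop where
  hasFDerivAt : ∀ u : ℂ, u.re ≤ t₀ → HasFDerivAt H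
    (ContinuousLinearMap.mul ℝ 𝔸 (H u) ∘L (Complex.reCLM.smulRight (ζ • (1 : 𝔸)) + η u)) u
  norm_le : ∀ u : ℂ, u.re ≤ t₀ → ∀ a : ℂ,
    ‖η u a + a.re • A - a.im • B‖ ≤ C * Real.exp u.re * ‖a‖

namespace IsPoleSolution

variable {ζ C t₀ : ℝ} {A B Pp P₀ Pm : 𝔸} {H : ℂ → 𝔸} {η : ℂ → ℂ →L[ℝ] 𝔸}

theorem radial (hH : IsPoleSolution ζ A B C t₀ H η) (y : ℝ) :
    IsRadialSolution ζ A C t₀ (fun s : ℝ => H (s + y * Complex.I))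
      (fun s : ℝ => η (s + y * Complex.I) 1 + A) where
  hasDerivAt s hs := by
    have h1 : HasDerivAt (fun s : ℝ => (s : ℂ) + y * Complex.I) 1 s :=
      (Complex.ofRealCLM.hasDerivAt (x := s)).add_const _
    refine ((hH.hasFDerivAt _ (by simpa using hs)).comp_hasDerivAt s h1).congr_deriv ?_
    simp [mul_add]
  norm_le s hs := by simpa using hH.norm_le (s + y * Complex.I) (by simpa using hs) 1

theorem hasDerivAt_angular (hH : IsPoleSolution ζ A B C t₀ H η) {t : ℝ} (ht : t ≤ t₀) (y : ℝ) :
    HasDerivAt (fun y : ℝ => H (t + y * Complex.I))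
      (H (t + y * Complex.I) * η (t + y * Complex.I) Complex.I) y := by
  have h1 : HasDerivAt (fun y : ℝ => (t : ℂ) + y * Complex.I) Complex.I y := by
    simpa using ((Complex.ofRealCLM.hasDerivAt (x := y)).mul_const Complex.I).const_add (t : ℂ)
  refine ((hH.hasFDerivAt _ (by simpa using ht)).comp_hasDerivAt y h1).congr_deriv ?_
  simp

theorem exists_norm_le (hH : IsPoleSolution ζ A B C t₀ H η) (hζ : 0 < ζ)
    (hA : IsSpectralSplitting ζ A Pp P₀ Pm)
    (hsmall : (‖Pp‖ + ‖P₀‖ + ‖Pm‖) * C * Real.exp t₀ ≤ 1 / 2) (M : ℝ) :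
    ∃ N, ∀ t ≤ t₀, ∀ y ∈ Icc (-M) M, ‖H (t + y * Complex.I)‖ ≤ N := by
  obtain ⟨N, hN⟩ := isCompact_Icc.exists_bound_of_continuousOn (s := Icc (-M) M)
    (f := fun y : ℝ => H (t₀ + y * Complex.I))
    fun y _ => (hH.hasDerivAt_angular le_rfl y).continuousAt.continuousWithinAt
  refine ⟨2 * (‖Pp‖ + ‖P₀‖ + ‖Pm‖) * N, fun t ht y hy => ?_⟩
  refine ((hH.radial y).norm_le_mul hζ hA hsmall ht le_rfl).trans ?_
  gcongr
  exact hN y hy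

theorem nonneg (hH : IsPoleSolution ζ A B C t₀ H η) : 0 ≤ C := (hH.radial 0).nonneg

/-- Along `Re u → -∞` with bounded imaginary part, `H u` converges uniformly, and the limit vanishes
on the images of `P₀` and `P₋`. On the image of `P₊`
the limit does not depend on the imaginary part, because `B` vanishes there. -/
theorem exists_limit [CompleteSpace 𝔸] (hH : IsPoleSolution ζ A B C t₀ H η) (hζ : 0 < ζ)
    (hA : IsSpectralSplitting ζ A Pp P₀ Pm) (hB : B * Pp = 0) (ht₀ : t₀ ≤ 0)
    (hsmall : (‖Pp‖ + ‖P₀‖ + ‖Pm‖) * C * Real.exp t₀ ≤ 1 / 2) :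
    ∃ Q : 𝔸, Q * Pp = Q ∧ ∀ M : ℝ, ∃ b : ℝ → ℝ, Tendsto b atBot (𝓝 0) ∧
      ∀ t ≤ t₀, ∀ y ∈ Icc (-M) M, ‖H (t + y * Complex.I) - Q‖ ≤ b t := by
  have hC0 := hH.nonneg
  obtain ⟨N₀, hN₀⟩ := hH.exists_norm_le hζ hA hsmall 0
  have hN₀' : ∀ t : ℝ, t ≤ t₀ → ‖H t‖ ≤ N₀ := fun t ht => by simpa using hN₀ t ht 0 (by simp)
  have hN₀0 : 0 ≤ N₀ := (norm_nonneg _).trans (hN₀' t₀ le_rfl)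
  -- the limit along the negative real axis, on the image of `P₊`
  have hcau : ∀ t t₁ : ℝ, t ≤ t₁ → t₁ ≤ t₀ →
      ‖H t₁ * Pp - H t * Pp‖ ≤ N₀ * C * ‖Pp‖ * Real.exp t₁ := fun t t₁ h1 h2 => by
    have := (hH.radial 0).norm_mul_pos_sub_le hA.mul_pos h1 h2
      (fun s hs => by simpa using hN₀' s (hs.2.trans h2))
    simpa using this
  have hexp : Tendsto (fun n : ℕ => Real.exp (t₀ - n)) atTop (𝓝 0) :=
    Real.tendsto_exp_atBot.comp
      (tendsto_atBot_add_const_left _ _ (tendsto_neg_atTop_atBot.comp tendsto_natCast_atTop_atTop))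
  have hseq : CauchySeq fun n : ℕ => H ((t₀ - n : ℝ) : ℂ) * Pp := by
    refine cauchySeq_of_le_tendsto_0 (fun n : ℕ => N₀ * C * ‖Pp‖ * Real.exp (t₀ - n)) ?_
      (by simpa using hexp.const_mul (N₀ * C * ‖Pp‖))
    have key : ∀ n m L : ℕ, L ≤ n → n ≤ m → dist (H ((t₀ - n : ℝ) : ℂ) * Pp)
        (H ((t₀ - m : ℝ) : ℂ) * Pp) ≤ N₀ * C * ‖Pp‖ * Real.exp (t₀ - L) := by
      intro n m L h1 h2
      have h1' : (L : ℝ) ≤ n := by exact_mod_cast h1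
      have h2' : (n : ℝ) ≤ m := by exact_mod_cast h2
      rw [dist_eq_norm]
      refine (hcau _ _ (by linarith) (by linarith [L.cast_nonneg (α := ℝ)])).trans ?_
      gcongr
    intro n m L h1 h2
    rcases le_total n m with h | h
    · exact key n m L h1 h
    · rw [dist_comm]; exact key m n L h2 h
  obtain ⟨Q, hQ⟩ := cauchySeq_tendsto_of_complete hseq
  have hQt : ∀ t : ℝ, t ≤ t₀ → ‖H t * Pp - Q‖ ≤ N₀ * C * ‖Pp‖ * Real.exp t := by
    intro t ht
    refine le_of_tendsto ((tendsto_const_nhds.sub hQ).norm) ?_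
    filter_upwards [eventually_ge_atTop ⌈t₀ - t⌉₊] with n hn
    exact hcau _ _ (by linarith [Nat.ceil_le.1 hn]) ht
  suffices hmain : ∀ M : ℝ, ∃ b : ℝ → ℝ, Tendsto b atBot (𝓝 0) ∧
      ∀ t ≤ t₀, ∀ y ∈ Icc (-M) M, ‖H (t + y * Complex.I) - Q‖ ≤ b t by
    refine ⟨Q, ?_, hmain⟩
    obtain ⟨b, hb, hbound⟩ := hmain 0
    have h1 : Tendsto (fun t : ℝ => H t) atBot (𝓝 Q) := by
      refine tendsto_iff_norm_sub_tendsto_zero.2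
        (squeeze_zero' (.of_forall fun _ => norm_nonneg _) ?_ hb)
      filter_upwards [eventually_le_atBot t₀] with t ht
      simpa using hbound t ht 0 (by simp)
    have h2 : Tendsto (fun t : ℝ => H t * Pp) atBot (𝓝 Q) := by
      refine tendsto_iff_norm_sub_tendsto_zero.2
        (squeeze_zero' (.of_forall fun _ => norm_nonneg _) ?_
          (by simpa using Real.tendsto_exp_atBot.const_mul (N₀ * C * ‖Pp‖)))
      filter_upwards [eventually_le_atBot t₀] with t ht using hQt t ht
    exact tendsto_nhds_unique (h1.mul_const Pp) h2
  intro M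
  obtain ⟨N, hN⟩ := hH.exists_norm_le hζ hA hsmall (max M 0)
  set M' := max M 0
  have h0M : (0 : ℝ) ∈ Icc (-M') M' := ⟨neg_nonpos.2 (le_max_right _ _), le_max_right _ _⟩
  have hN0 : 0 ≤ N := (norm_nonneg _).trans (hN t₀ le_rfl 0 h0M)
  have hang : ∀ t ≤ t₀, ∀ y ∈ Icc (-M') M',
      ‖H (t + y * Complex.I) * Pp - H t * Pp‖ ≤ N * C * ‖Pp‖ * Real.exp t * M' := by
    intro t ht y hy
    have h1 := (convex_Icc (-M') M').norm_image_sub_le_of_norm_hasDerivWithin_le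
      (f := fun y : ℝ => H (t + y * Complex.I) * Pp) (C := N * C * ‖Pp‖ * Real.exp t)
      (fun y _ => ((hH.hasDerivAt_angular ht y).mul_const Pp).hasDerivWithinAt)
      (fun y hy => ?_) h0M hy
    · refine (by simpa using h1 : _ ≤ N * C * ‖Pp‖ * Real.exp t * |y|).trans ?_
      gcongr
      exact abs_le.2 hy
    · have h2 : η (t + y * Complex.I) Complex.I * Pp
          = (η (t + y * Complex.I) Complex.I - B) * Pp := by rw [sub_mul, hB, sub_zero]
      have h3 := hH.norm_le (t + y * Complex.I) (by simpa using ht) Complex.I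
      simp only [Complex.I_re, Complex.I_im, zero_smul, one_smul, add_zero, Complex.norm_I, mul_one,
        Complex.add_re, Complex.ofReal_re, Complex.mul_re, Complex.ofReal_im, mul_zero,
        sub_zero] at h3
      rw [mul_assoc, h2]
      calc _ ≤ ‖H (t + y * Complex.I)‖ * (‖η (t + y * Complex.I) Complex.I - B‖ * ‖Pp‖) :=
            (norm_mul_le _ _).trans (by gcongr; exact norm_mul_le _ _)
        _ ≤ N * (C * Real.exp t * ‖Pp‖) := by
            gcongr
            exact hN t ht y hy
        _ = _ := by ring
  let k : ℝ := min (ζ / 2) 1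
  have hk0 : 0 < k := lt_min (by linarith) one_pos
  have hkζ : k < ζ := (min_le_left _ _).trans_lt (by linarith)
  let b : ℝ → ℝ := fun t => (N * C * ‖Pp‖ * Real.exp t * M' + N₀ * C * ‖Pp‖ * Real.exp t)
    + (Real.exp (ζ * (t - t₀)) * (N * ‖P₀‖) + N * C * ‖P₀‖ / (ζ - k) * Real.exp (k * t))
    + (Real.exp (2 * ζ * (t - t₀)) * (N * ‖Pm‖) + N * C * ‖Pm‖ / (2 * ζ - k) * Real.exp (k * t))
  have hlim : ∀ l : ℝ, 0 < l → ∀ a : ℝ, Tendsto (fun t => Real.exp (l * (t - a))) atBot (𝓝 0) :=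
    fun l hl a => Real.tendsto_exp_atBot.comp
      ((tendsto_atBot_add_const_right _ (-a) tendsto_id).const_mul_atBot hl)
  have hlim' : Tendsto (fun t => Real.exp (k * t)) atBot (𝓝 0) := by simpa using hlim k hk0 0
  refine ⟨b, ?_, fun t ht y hy => ?_⟩
  · have := (((((Real.tendsto_exp_atBot.const_mul (N * C * ‖Pp‖)).mul_const M').add
      (Real.tendsto_exp_atBot.const_mul (N₀ * C * ‖Pp‖)))).add
      (((hlim ζ hζ t₀).mul_const (N * ‖P₀‖)).add (hlim'.const_mul (N * C * ‖P₀‖ / (ζ - k))))).add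
      (((hlim (2 * ζ) (by linarith) t₀).mul_const (N * ‖Pm‖)).add
        (hlim'.const_mul (N * C * ‖Pm‖ / (2 * ζ - k))))
    simpa [b] using this
  have hy' : y ∈ Icc (-M') M' :=
    ⟨by linarith [hy.1, le_max_left M 0], hy.2.trans (le_max_left _ _)⟩
  have hdec : ∀ (P : 𝔸) (l : ℝ), A * P = (ζ - l) • P → k < l → ‖H (t + y * Complex.I) * P‖
      ≤ Real.exp (l * (t - t₀)) * (N * ‖P‖) + N * C * ‖P‖ / (l - k) * Real.exp (k * t) := by
    intro P l hP hkl
    refine ((hH.radial y).norm_mul_le_of_decay hP hkl (min_le_right _ _) ht₀ ht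
      (fun s hs => hN s hs.2 y hy')).trans ?_
    gcongr
    exact (norm_mul_le _ _).trans (by gcongr; exact hN t₀ le_rfl y hy')
  have hsplit : H (t + y * Complex.I) - Q = ((H (t + y * Complex.I) * Pp - H t * Pp)
      + (H t * Pp - Q)) + H (t + y * Complex.I) * P₀ + H (t + y * Complex.I) * Pm := by
    conv_lhs => rw [← mul_one (H (t + y * Complex.I)), ← hA.sum_eq]
    simp only [mul_add]
    abel
  rw [hsplit]
  refine norm_add₃_le.trans (add_le_add (add_le_add ?_ ?_) ?_)
  · exact (norm_add_le _ _).trans (add_le_add (hang t ht y hy') (hQt t ht))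
  · exact hdec P₀ ζ (by simp [hA.mul_zero]) hkζ
  · exact hdec Pm (2 * ζ) (by rw [hA.mul_neg]; module) (by linarith)

/-- The limit, normalized at `p`, tends to `P₊` as `Re p → -∞`, uniformly in the imaginary part. -/
theorem norm_inv_mul_limit_sub_le (hH : IsPoleSolution ζ A B C t₀ H η) (hζ : 0 < ζ)
    (hA : IsSpectralSplitting ζ A Pp P₀ Pm)
    (hsmall : (‖Pp‖ + ‖P₀‖ + ‖Pm‖) * C * Real.exp t₀ ≤ 1 / 2) {Q : 𝔸}
    (hQ : ∀ y : ℝ, Tendsto (fun t : ℝ => H (t + y * Complex.I)) atBot (𝓝 Q)) (hQP : Q * Pp = Q)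
    {p : ℂ} (hp : p.re ≤ t₀) {L : 𝔸} (hL : L * H p = 1) :
    ‖L * Q - Pp‖ ≤ 2 * (‖Pp‖ + ‖P₀‖ + ‖Pm‖) * ‖(1 : 𝔸)‖ * C * ‖Pp‖ * Real.exp p.re := by
  have hX := (hH.radial p.im).const_mul L
  have hp1 : L * H (p.re + p.im * Complex.I) = 1 := by rwa [Complex.re_add_im]
  have hlim : Tendsto (fun t : ℝ => L * H (t + p.im * Complex.I) * Pp) atBot (𝓝 (L * Q)) := by
    have := ((hQ p.im).const_mul L).mul_const Pp
    rwa [mul_assoc, hQP] at this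
  refine le_of_tendsto (hlim.sub_const Pp).norm ?_
  filter_upwards [eventually_le_atBot p.re] with t ht
  rw [norm_sub_rev]
  have := hX.norm_mul_pos_sub_le hA.mul_pos ht hp
    (fun s hs => hX.norm_le_mul hζ hA hsmall hs.2 hp)
  simpa only [hp1, one_mul] using this

end IsPoleSolution

end HalfPlaneLimit

/-! ### The residue of a Minkowski pure pole form -/

section Residue

variable {n : ℕ} {v w x y Vp Vm : Mink n} {ζ : ℝ}

theorem isSkew_wedge (v w : Mink n) : IsSkew (wedge v w) := by
  intro a b
  simp only [wedge_apply, sub_eq_add_neg, ip_add_left, ip_add_right, ip_smul_left,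
    ip_smul_right, ← neg_smul]
  rw [ip_comm a w, ip_comm a v]
  ring

theorem wedge_apply_mem_span (v w z : Mink n) : wedge v w z ∈ Submodule.span ℝ {v, w} :=
  Submodule.sub_mem _ (Submodule.smul_mem _ _ (Submodule.subset_span (by simp)))
    (Submodule.smul_mem _ _ (Submodule.subset_span (by simp)))

theorem mem_span_of_wedge_eq_smul {z : Mink n} {l : ℝ} (hl : l ≠ 0) (hz : wedge v w z = l • z) :
    z ∈ Submodule.span ℝ {v, w} := by
  have := Submodule.smul_mem _ l⁻¹ (wedge_apply_mem_span v w z)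
  rwa [hz, smul_smul, inv_mul_cancel₀ hl, one_smul] at this

theorem ip_self_eq_zero_of_isSkew {A : EndMink n} (hA : IsSkew A) {z : Mink n} {l : ℝ} (hl : l ≠ 0)
    (hz : A z = l • z) : ip z z = 0 := by
  have h := hA z z
  rw [hz, ip_smul_left, ip_smul_right] at h
  have : (2 * l) * ip z z = 0 := by linarith
  exact (mul_eq_zero.1 this).resolve_left (by simpa using hl)

theorem span_eigenvectors (hζ : 0 < ζ) (hp0 : Vp ≠ 0) (hp : wedge v w Vp = ζ • Vp) (hm0 : Vm ≠ 0)
    (hm : wedge v w Vm = (-ζ) • Vm) : Submodule.span ℝ {v, w} = Submodule.span ℝ {Vp, Vm} := by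
  have hli : LinearIndependent ℝ ![Vp, Vm] := by
    rw [LinearIndependent.pair_iff]
    intro a b hab
    have h1 := congrArg (wedge v w) hab
    rw [map_add, map_smul, map_smul, hp, hm, map_zero] at h1
    have h2 : (2 * ζ * a) • Vp = 0 := by
      have : (2 * ζ * a) • Vp = ζ • (a • Vp + b • Vm) + (a • ζ • Vp + b • (-ζ) • Vm) := by module
      rw [this, hab, h1]; simp
    have ha : a = 0 := by
      have := (smul_eq_zero.1 h2).resolve_right hp0
      simpa [hζ.ne'] using this
    rw [ha, zero_smul, zero_add] at hab
    exact ⟨ha, (smul_eq_zero.1 hab).resolve_right hm0⟩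
  have hle : Submodule.span ℝ {Vp, Vm} ≤ Submodule.span ℝ {v, w} := by
    rw [Submodule.span_le]
    rintro z (rfl | rfl)
    · exact mem_span_of_wedge_eq_smul hζ.ne' hp
    · exact mem_span_of_wedge_eq_smul (neg_ne_zero.2 hζ.ne') hm
  refine (Submodule.eq_of_le_of_finrank_le hle ?_).symm
  have h1 := finrank_span_eq_card hli
  rw [Matrix.range_cons, Matrix.range_cons, Matrix.range_empty, union_empty,
    singleton_union, Fintype.card_fin] at h1
  rw [h1]
  have h2 := finrank_span_finset_le_card (R := ℝ) ({v, w} : Finset (Mink n))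
  simp only [Finset.coe_insert, Finset.coe_singleton] at h2
  exact h2.trans Finset.card_le_two

/-- Otherwise the span of the null vectors `V±`, which is that of `v` and `w`, would be totally
isotropic. -/
theorem ip_eigenvectors_ne_zero (hmink : SpanIsMinkowski v w) (hζ : 0 < ζ) (hp0 : Vp ≠ 0)
    (hp : wedge v w Vp = ζ • Vp) (hm0 : Vm ≠ 0) (hm : wedge v w Vm = (-ζ) • Vm) :
    ip Vp Vm ≠ 0 := by
  intro h0
  obtain ⟨z, hz, hz0⟩ := hmink.2
  rw [span_eigenvectors hζ hp0 hp hm0 hm, Submodule.mem_span_pair] at hz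
  obtain ⟨a, b, rfl⟩ := hz
  have h1 := ip_self_eq_zero_of_isSkew (isSkew_wedge v w) hζ.ne' hp
  have h2 := ip_self_eq_zero_of_isSkew (isSkew_wedge v w) (neg_ne_zero.2 hζ.ne') hm
  simp [ip_add_left, ip_add_right, ip_smul_left, ip_smul_right, h1, h2, ip_comm Vm Vp, h0] at hz0

/-- The projections onto the null eigenlines and onto their orthogonal complement, on which the
wedge product of `v` and `w` vanishes. -/
theorem isSpectralSplitting_wedge (hζ : 0 < ζ) (hp0 : Vp ≠ 0)
    (hp : wedge v w Vp = ζ • Vp) (hm0 : Vm ≠ 0) (hm : wedge v w Vm = (-ζ) • Vm)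
    (hne : ip Vp Vm ≠ 0) :
    IsSpectralSplitting ζ (wedge v w) ((ip Vp Vm)⁻¹ • outer Vp Vm)
      (1 - (ip Vp Vm)⁻¹ • outer Vp Vm - (ip Vp Vm)⁻¹ • outer Vm Vp)
      ((ip Vp Vm)⁻¹ • outer Vm Vp) where
  sum_eq := by abel
  mul_pos := by
    ext1 z
    simp [outer_apply, hp, smul_smul]
    congr 1
    ring
  mul_zero := by
    have h1 := ip_self_eq_zero_of_isSkew (isSkew_wedge v w) hζ.ne' hp
    have h2 := ip_self_eq_zero_of_isSkew (isSkew_wedge v w) (neg_ne_zero.2 hζ.ne') hm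
    ext1 z
    rw [mul_apply_eq_comp]
    set u := (1 - (ip Vp Vm)⁻¹ • outer Vp Vm - (ip Vp Vm)⁻¹ • outer Vm Vp : EndMink n) z with hu
    have hu' : u = z - (ip Vp Vm)⁻¹ • ip Vm z • Vp - (ip Vp Vm)⁻¹ • ip Vp z • Vm := rfl
    have hup : ip Vp u = 0 := by
      rw [hu', ip_sub_right, ip_sub_right]
      simp only [ip_smul_right, h1]
      field_simp
      ring
    have hum : ip Vm u = 0 := by
      rw [hu', ip_sub_right, ip_sub_right]
      simp only [ip_smul_right, h2, ip_comm Vm Vp]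
      field_simp
      ring
    have hperp : ∀ a ∈ Submodule.span ℝ {v, w}, ip a u = 0 := by
      intro a ha
      rw [span_eigenvectors hζ hp0 hp hm0 hm, Submodule.mem_span_pair] at ha
      obtain ⟨c, d, rfl⟩ := ha
      rw [ip_add_left, ip_smul_left, ip_smul_left, hup, hum]
      simp
    rw [wedge_apply, hperp v (Submodule.subset_span (by simp)),
      hperp w (Submodule.subset_span (by simp))]
    simp
  mul_neg := by
    ext1 z
    simp [outer_apply, hm, smul_smul]
    congr 1
    ring

theorem wedge_apply_eq_zero (horth : SpansOrthogonal x y v w) {z : Mink n}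
    (hz : z ∈ Submodule.span ℝ {v, w}) : wedge x y z = 0 := by
  rw [wedge_apply, horth x (Submodule.subset_span (by simp)) z hz,
    horth y (Submodule.subset_span (by simp)) z hz]
  simp

end Residue

/-! ### The branch point -/

section BranchPoint

variable {Δ : Set ℂ}

theorem pullback_pureForm_apply {n : ℕ} (A B : EndMink n) (u a : ℂ) :
    pullback (pureForm A B) u a = -(a.re • A) + a.im • B := by
  simp [pullback, pureForm, Complex.exp_ne_zero]

theorem norm_pullback_sub_le {n : ℕ} {ψ ξ : Form n} {B : ℝ}
    (hB : ∀ z ∈ Δ \ {0}, ‖ψ z - ξ z‖ ≤ B) {u : ℂ} (hu : u ∈ cover Δ) (a : ℂ) :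
    ‖pullback ψ u a - pullback ξ u a‖ ≤ B * Real.exp u.re * ‖a‖ := by
  have h1 := (ψ (Complex.exp u) - ξ (Complex.exp u)).le_of_opNorm_le (hB _ (mapsTo_exp_cover hu))
    (Complex.exp u * a)
  rw [norm_mul, Complex.norm_exp, ← mul_assoc] at h1
  simpa [pullback] using h1

theorem halfPlane_subset_cover (h0 : (0 : ℂ) ∈ interior Δ) :
    ∃ t₁ : ℝ, ∀ u : ℂ, u.re ≤ t₁ → u ∈ cover Δ := by
  obtain ⟨ε, hε, hεΔ⟩ := Metric.nhds_basis_closedBall.mem_iff.1 (mem_interior_iff_mem_nhds.1 h0)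
  exact ⟨Real.log ε, fun u hu => hεΔ (by simpa using norm_exp_le_of_re_le hε hu)⟩

/-- Convergence to the branch point means that the real part of the logarithmic coordinate tends
to `-∞`. -/
theorem tendsto_re_toS (Δ : Set ℂ) :
    Tendsto (fun q : cover Δ => (q : ℂ).re) (toS Δ) atBot := by
  rw [tendsto_atBot]
  intro b
  refine ⟨insert BranchedCover.s (BranchedCover.pt '' {q : cover Δ | (q : ℂ).re < b}), ?_, ?_⟩
  · refine IsOpen.mem_nhds ⟨?_, fun _ => ⟨Real.exp b, Real.exp_pos b, fun q hq => ?_⟩⟩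
      (mem_insert _ _)
    · have : BranchedCover.pt ⁻¹' (insert BranchedCover.s
          (BranchedCover.pt '' {q : cover Δ | (q : ℂ).re < b})) = {q : cover Δ | (q : ℂ).re < b} := by
        ext q; simp
      rw [this]
      exact isOpen_lt (Complex.continuous_re.comp continuous_subtype_val) continuous_const
    · rw [Complex.norm_exp, Real.exp_lt_exp] at hq
      exact mem_insert_of_mem _ ⟨q, hq, rfl⟩
  · intro q hq
    have : (q : ℂ).re < b := by simpa using hq
    exact this.le

theorem ratio_rpow (q p : cover Δ) (ζ : ℝ) :
    ratio q p ^ ζ = Real.exp (ζ * (q : ℂ).re) * Real.exp (-(ζ * (p : ℂ).re)) := by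
  rw [ratio, ← Complex.exp_sub, Complex.norm_exp, ← Real.exp_mul, ← Real.exp_add, Complex.sub_re]
  congr 1
  ring

end BranchPoint

/-! ### The limiting section of the light cone -/

section Limit

variable {n : ℕ} {Δ : Set ℂ}

/-- A primitive of a pole form, weighted by `|z|^ζ`, solves the model equation on a half-plane. -/
theorem exists_isPoleSolution {ψ : Form n} {A B : EndMink n} (h0 : (0 : ℂ) ∈ interior Δ)
    (hψ : IsPoleForm Δ ψ (pureForm A B)) {G : ℂ → EndMink n}
    (hG : IsPrimitiveWithin G (pullback ψ) (cover Δ)) (ζ c : ℝ) :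
    ∃ C t₀ : ℝ, t₀ ≤ 0 ∧ c * C * Real.exp t₀ ≤ 1 / 2 ∧ (∀ u : ℂ, u.re ≤ t₀ → u ∈ cover Δ) ∧
      IsPoleSolution ζ A B C t₀ (fun u => Real.exp (ζ * u.re) • G u) (pullback ψ) := by
  obtain ⟨C, hC⟩ := hψ.bounded
  obtain ⟨t₁, ht₁⟩ := halfPlane_subset_cover h0
  set κ := 2 * (|c * C| + 1) with hκ
  have hκ0 : 0 < κ := by positivity
  set t₀ := min (t₁ - 1) (min 0 (Real.log κ⁻¹)) with ht₀
  have hlt : t₀ < t₁ := (min_le_left _ _).trans_lt (by linarith)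
  have hexp : Real.exp t₀ ≤ κ⁻¹ := by
    rw [← Real.le_log_iff_exp_le (inv_pos.2 hκ0)]
    exact (min_le_right _ _).trans (min_le_right _ _)
  refine ⟨C, t₀, (min_le_right _ _).trans (min_le_left _ _), ?_, fun u hu => ht₁ u (hu.trans hlt.le),
    fun u hu => ?_, fun u hu a => ?_⟩
  · calc c * C * Real.exp t₀ ≤ (|c * C| + 1) * κ⁻¹ := by
          gcongr
          linarith [le_abs_self (c * C)]
      _ = 1 / 2 := by rw [hκ]; field_simp
  · have hmem : cover Δ ∈ 𝓝 u := by
      refine mem_of_superset ((isOpen_lt Complex.continuous_re continuous_const).mem_nhds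
        (hu.trans_lt hlt)) fun v (hv : v.re < t₁) => ht₁ v hv.le
    have h1 := (hG u (mem_of_mem_nhds hmem)).hasFDerivAt hmem
    have h2 : HasFDerivAt (fun u : ℂ => Real.exp (ζ * u.re))
        (Real.exp (ζ * u.re) • ζ • Complex.reCLM) u :=
      (Complex.reCLM.hasFDerivAt.const_mul ζ).exp
    refine (h2.smul h1).congr_fderiv ?_
    ext a z
    simp [smul_smul, mul_assoc]
    ring
  · have := norm_pullback_sub_le hC (ht₁ u (hu.trans hlt.le)) a
    rw [pullback_pureForm_apply] at this
    rwa [sub_add_eq_sub_sub, sub_neg_eq_add] at this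

end Limit

end PoleForm

open PoleForm in
theorem proposition3p7 (n : ℕ) (Δ : Set ℂ) (hΔ : PoleForm.IsDiscAroundZero Δ)
    (v w x y : PoleForm.Mink n)
    (horth : PoleForm.SpansOrthogonal x y v w)
    (hmink : PoleForm.SpanIsMinkowski v w)
    (ψ : PoleForm.Form n)
    (hψ : PoleForm.IsPoleForm Δ ψ
      (PoleForm.pureForm (PoleForm.wedge v w) (PoleForm.wedge x y)))
    (ζ : ℝ) (hζ : 0 < ζ) (Vplus Vminus : PoleForm.Mink n)
    (hVplus0 : Vplus ≠ 0) (hVplus : PoleForm.wedge v w Vplus = ζ • Vplus)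
    (hVminus0 : Vminus ≠ 0) (hVminus : PoleForm.wedge v w Vminus = (-ζ) • Vminus) :
    ∃ K : ℂ → PoleForm.Mink n,
      ContDiffOn ℝ ∞ K (PoleForm.cover Δ) ∧
      (∀ p : PoleForm.cover Δ, K p ∈ PoleForm.lightCone n) ∧
      (∀ p q : PoleForm.cover Δ,
        K p = (PoleForm.ratio q p ^ ζ) • PoleForm.primitive Δ ψ p q (K q)) ∧
      Tendsto (fun q : PoleForm.cover Δ => K q) (PoleForm.toS Δ)
        (𝓝 ((PoleForm.ip Vplus Vminus)⁻¹ • Vplus)) ∧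
      ∀ C : Set (PoleForm.cover Δ), PoleForm.IsApproachSet C → ∀ p : PoleForm.cover Δ,
        Tendsto (fun q : PoleForm.cover Δ =>
            (PoleForm.ratio q p ^ ζ) • PoleForm.primitive Δ ψ p q)
          (PoleForm.toS Δ ⊓ 𝓟 C) (𝓝 (PoleForm.outer (K p) Vminus)) ∧
        Tendsto (fun q : PoleForm.cover Δ =>
            (PoleForm.ratio q p ^ ζ) • PoleForm.primitive Δ ψ q p)
          (PoleForm.toS Δ ⊓ 𝓟 C) (𝓝 (PoleForm.outer Vminus (K p))) := by
  have hne := ip_eigenvectors_ne_zero hmink hζ hVplus0 hVplus hVminus0 hVminus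
  have hA := isSpectralSplitting_wedge hζ hVplus0 hVplus hVminus0 hVminus hne
  have hnull := ip_self_eq_zero_of_isSkew (isSkew_wedge v w) hζ.ne' hVplus
  set c := ip Vplus Vminus with hc
  set Pp : EndMink n := c⁻¹ • outer Vplus Vminus with hPp
  set P₀ : EndMink n := 1 - c⁻¹ • outer Vplus Vminus - c⁻¹ • outer Vminus Vplus
  set Pm : EndMink n := c⁻¹ • outer Vminus Vplus
  have hPpz : ∀ z, Pp z = (c⁻¹ * ip Vminus z) • Vplus := fun z => by
    simp [hPp, outer_apply, smul_smul]
  have hPpVp : Pp Vplus = Vplus := by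
    rw [hPpz, ip_comm, inv_mul_cancel₀ hne, one_smul]
  have hB : wedge x y * Pp = 0 := by
    ext1 z
    rw [mul_apply_eq_comp, hPpz, map_smul, wedge_apply_eq_zero horth
      (mem_span_of_wedge_eq_smul hζ.ne' hVplus), smul_zero, zero_apply]
  obtain ⟨G, hG, hGs, hGa, hGa', hprim⟩ := exists_lorentz_primitive hΔ hψ
  obtain ⟨C, t₀, ht₀, hsmall, hcov, hH⟩ := exists_isPoleSolution hΔ.2 hψ hG ζ
    (‖Pp‖ + ‖P₀‖ + ‖Pm‖)
  obtain ⟨Q, hQP, hQ⟩ := hH.exists_limit hζ hA hB ht₀ hsmall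
  set H : ℂ → EndMink n := fun u => Real.exp (ζ * u.re) • G u with hHdef
  have hray : ∀ y : ℝ, Tendsto (fun t : ℝ => H (t + y * Complex.I)) atBot (𝓝 Q) := by
    intro y
    obtain ⟨b, hb, hbound⟩ := hQ |y|
    refine tendsto_iff_norm_sub_tendsto_zero.2 (squeeze_zero' (.of_forall fun _ => norm_nonneg _)
      ?_ hb)
    filter_upwards [eventually_le_atBot t₀] with t ht
    exact hbound t ht y ⟨neg_abs_le y, le_abs_self y⟩
  -- the limit has rank one, and its image is spanned by the null vector `K₀`
  set K₀ : Mink n := c⁻¹ • Q Vplus with hK₀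
  have hQK : Q = outer K₀ Vminus := by
    ext1 z
    rw [← hQP, mul_apply_eq_comp, hPpz, map_smul, outer_apply, hK₀, smul_smul, mul_comm]
  have hip : ∀ u ∈ cover Δ, ∀ a b, ip (G u a) (G u b) = ip a b := fun u hu a b => by
    rw [← ip_adj_right, ← mul_apply_eq_comp, hGa' u hu, one_apply_eq_self]
  have hip' : ∀ u ∈ cover Δ, ∀ a b, ip (adj (G u) a) (adj (G u) b) = ip a b := fun u hu a b => by
    rw [ip_adj_right, ← mul_apply_eq_comp, hGa u hu, one_apply_eq_self]
  have hK₀null : ip K₀ K₀ = 0 := by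
    have h1 : Tendsto (fun t : ℝ => H (t + (0 : ℝ) * Complex.I) Vplus) atBot (𝓝 (Q Vplus)) :=
      (ContinuousLinearMap.apply ℝ (Mink n) Vplus).continuous.tendsto _ |>.comp (hray 0)
    have h2 := (continuous_ip.tendsto (Q Vplus, Q Vplus)).comp (h1.prodMk_nhds h1)
    have h3 : ip (Q Vplus) (Q Vplus) = 0 := by
      refine tendsto_nhds_unique h2 (tendsto_const_nhds.congr' ?_)
      filter_upwards [eventually_le_atBot t₀] with t ht
      simp [hHdef, ip_smul_left, ip_smul_right, hip t (hcov t (by simpa using ht)), hnull]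
    rw [hK₀, ip_smul_left, ip_smul_right, h3, mul_zero, mul_zero]
  let L : ℂ → EndMink n := fun u => Real.exp (-(ζ * u.re)) • adj (G u)
  let K : ℂ → Mink n := fun u => L u K₀
  have hLQ : ∀ u, L u * Q = outer (K u) Vminus := fun u => by
    ext1 z
    rw [mul_apply_eq_comp, hQK, outer_apply, outer_apply, map_smul]
  have hLH : ∀ u ∈ cover Δ, L u * H u = 1 := fun u hu => by
    ext1 z
    have := congrArg (fun T : EndMink n => T z) (hGa' u hu)
    simp only [mul_apply_eq_comp] at this
    simp [L, hHdef, this, smul_smul, ← Real.exp_add]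
  have hHL : ∀ u ∈ cover Δ, H u (K u) = K₀ := fun u hu => by
    have := congrArg (fun T : EndMink n => T K₀) (hGa u hu)
    simp only [mul_apply_eq_comp] at this
    simp [K, L, hHdef, this, smul_smul, ← Real.exp_add]
  have hprimLH : ∀ p q : cover Δ, (ratio q p ^ ζ) • primitive Δ ψ p q = L p * H q := fun p q => by
    ext1 z
    simp [L, hHdef, ratio_rpow, hprim, smul_smul]
  have hLQb : ∀ u : ℂ, u.re ≤ t₀ → ‖L u * Q - Pp‖ ≤ _ := fun u hu =>
    hH.norm_inv_mul_limit_sub_le hζ hA hsmall hray hQP hu (hLH u (hcov u hu))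
  set D := 2 * (‖Pp‖ + ‖P₀‖ + ‖Pm‖) * ‖(1 : EndMink n)‖ * C * ‖Pp‖
  have hKlim : Tendsto (fun q : cover Δ => K q) (toS Δ) (𝓝 (c⁻¹ • Vplus)) := by
    have h1 : ∀ q : cover Δ, (q : ℂ).re ≤ t₀ →
        ‖K q - c⁻¹ • Vplus‖ ≤ D * Real.exp (q : ℂ).re * ‖c⁻¹ • Vplus‖ := fun q hq => by
      have h3 := (L q * Q - Pp).le_of_opNorm_le (hLQb q hq) (c⁻¹ • Vplus)
      rwa [sub_apply, map_smul Pp, hPpVp, hLQ, outer_apply, ip_smul_right, ip_comm, ← hc,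
        inv_mul_cancel₀ hne, one_smul] at h3
    refine tendsto_iff_norm_sub_tendsto_zero.2
      (squeeze_zero' (.of_forall fun _ => norm_nonneg _)
        (((tendsto_re_toS Δ).eventually_le_atBot t₀).mono h1) ?_)
    simpa using ((Real.tendsto_exp_atBot.comp (tendsto_re_toS Δ)).const_mul D).mul_const
      ‖c⁻¹ • Vplus‖
  have hK₀ne : K₀ ≠ 0 := by
    intro h
    have hQ0 : Q = 0 := by
      ext1 z
      rw [hQK, h, outer_apply, smul_zero, zero_apply]
    have h1 : ‖Pp‖ ≤ 0 := by
      refine ge_of_tendsto (f := fun t : ℝ => D * Real.exp t) (x := atBot)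
        (by simpa using Real.tendsto_exp_atBot.const_mul D) ?_
      filter_upwards [eventually_le_atBot t₀] with t ht
      simpa [hQ0] using hLQb t (by simpa using ht)
    rw [norm_le_zero_iff.1 h1, zero_apply] at hPpVp
    exact hVplus0 hPpVp.symm
  refine ⟨K, ?_, fun p => ⟨fun h => hK₀ne ?_, ?_⟩, fun p q => ?_, hKlim, fun S hS p => ?_⟩
  · have h1 : ContDiff ℝ ∞ fun u : ℂ => Real.exp (-(ζ * u.re)) :=
      ((Complex.reCLM.contDiff.const_smul ζ).neg).exp
    exact (h1.contDiffOn.smul (adj.contDiff.comp_contDiffOn hGs)).clm_apply contDiffOn_const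
  · rw [← hHL p p.2, h, map_zero]
  · simp [K, L, ip_smul_left, ip_smul_right, hip' p p.2, hK₀null]
  · have := congrArg (fun T : EndMink n => T (K q)) (hprimLH p q)
    rw [smul_apply] at this
    rw [this, mul_apply_eq_comp, hHL q q.2]
  have hlim : Tendsto (fun q : cover Δ => (ratio q p ^ ζ) • primitive Δ ψ p q) (toS Δ ⊓ 𝓟 S)
      (𝓝 (outer (K p) Vminus)) := by
    obtain ⟨M, hM⟩ := hS.angle_bounded
    obtain ⟨b, hb, hbound⟩ := hQ M
    have h1 : Tendsto (fun q : cover Δ => H q) (toS Δ ⊓ 𝓟 S) (𝓝 Q) := by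
      refine tendsto_iff_norm_sub_tendsto_zero.2
        (squeeze_zero' (.of_forall fun _ => norm_nonneg _) ?_
          (hb.comp ((tendsto_re_toS Δ).mono_left inf_le_left)))
      filter_upwards [((tendsto_re_toS Δ).mono_left inf_le_left).eventually_le_atBot t₀,
        mem_inf_of_right (mem_principal_self S)] with q hq hqS
      simpa [Complex.re_add_im] using hbound _ hq (q : ℂ).im (abs_le.1 (hM q hqS))
    simp only [hprimLH]
    rw [← hLQ]
    exact h1.const_mul _
  refine ⟨hlim, ?_⟩
  have h1 := (adj.continuous.tendsto _).comp hlim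
  rw [adj_outer] at h1
  refine h1.congr fun q => ?_
  simp only [Function.comp_apply, map_smul, hprim, adj_mul, adj_adj]
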